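/- Let $M$ be a smooth manifold of dimension $n\ge 2$ with a conformal structure $[h]$. Fix a conformal scale, i.e. a representative metric $h_{\alpha\beta}$, with Levi-Civita connection $\nabla^h$; use $h$ to raise and lower indices and use the scale to trivialize the density bundles. Curvature conventions: $(\nabla^h_\alpha\nabla^h_\beta-\nabla^h_\beta\nabla^h_\alpha)X^\gamma=R^h_{\alpha\beta}{}^\gamma{}_\delta X^\delta$, $\mathrm{Ric}^h_{\beta\delta}=R^h_{\alpha\beta}{}^\alpha{}_\delta$; square brackets denote skew symmetrization (with the factor $1/2$), and $\mathrm{tf}$ the trace-free part. If $n\ge 3$, let $P^h_{\alpha\beta}=\frac1{n-2}\bigl(\mathrm{Ric}^h_{\alpha\beta}-\frac{\mathrm{scal}_h}{2(n-1)}h_{\alpha\beta}\bigr)$. If $n=2$, suppose in addition that a Möbius structure is given; in the fixed scale it is a symmetric tensor $\mathbb P_{\alpha\beta}$ with $\mathbb P_\alpha{}^\alpha=\frac12\mathrm{scal}_h$, and we set $P^h_{\alpha\beta}=\mathbb P_{\alpha\beta}$. Put $$Y_{\alpha\beta\gamma}=\nabla^h_{[\alpha}P^h_{\beta]\gamma},\qquad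 W^h_{\alpha\beta\gamma\delta}=R^h_{\alpha\beta\gamma\delta}-2\bigl(h_{\gamma[\alpha}P^h_{\beta]\delta}-h_{\delta[\alpha}P^h_{\beta]\gamma}\bigr).$$ In the fixed scale, sections of the conformal tractor bundle are triples $(\sigma,\mu^\beta,\varphi)$ (a function, a vector field, a function), and the conformal (for $n=2$: Möbius) tractor connection is $$\nabla_\alpha(\sigma,\mu^\beta,\varphi)=\bigl(\nabla^h_\alpha\sigma-\mu_\alpha,\ \nabla^h_\alpha\mu^\beta+\delta_\alpha{}^\beta\varphi+P^h_\alpha{}^\beta\sigma,\ \nabla^h_\alpha\varphi-P^h_{\alpha\gamma}\mu^\gamma\bigr).$$ Let $E_{\alpha\beta}$, $G_{\alpha\beta}$ be smooth symmetric tensors, $F_\alpha$ a smooth $1$-form, and $A_{\alpha\beta\gamma}$ a smooth totally symmetric trace-free tensor. Assume $E_\gamma{}^\gamma+G_\gamma{}^\gamma=0$ and, when $n=2$, also $\mathrm{tf}(E_{\alpha\beta}-G_{\alpha\beta})=0$. Let $\overline\nabla=\nabla-\widetilde A$, where $$\widetilde A_\alpha(\sigma,\mu^\beta,\varphi)=\bigl(0,\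 E_\alpha{}^\beta\sigma+A_{\alpha\gamma}{}^\beta\mu^\gamma,\ F_\alpha\sigma+G_{\alpha\gamma}\mu^\gamma\bigr).$$ Write $(\delta A)_{\alpha\beta}=\nabla^h_\gamma A_{\alpha\beta}{}^\gamma$, $(\delta^2A)_\alpha=\nabla_h^\beta(\delta A)_{\alpha\beta}$, $|A|^2=A_{\alpha\beta\gamma}A^{\alpha\beta\gamma}$, and $$P^A_{\alpha\beta}=\frac1{n-2}\Bigl(A_{\alpha\mu\nu}A_\beta{}^{\mu\nu}-\frac{|A|^2}{2(n-1)}h_{\alpha\beta}\Bigr)\ (n\ge3),\qquad P^A_{\alpha\beta}=\tfrac14|A|^2h_{\alpha\beta}\ (n=2).$$ Then $\overline\nabla$ is flat if and only if the following two conditions hold. (i) $$E_{\alpha\beta}=-\tfrac1n(\delta A)_{\alpha\beta}+P^A_{\alpha\beta},\qquad G_{\alpha\beta}=-\tfrac1n(\delta A)_{\alpha\beta}-P^A_{\alpha\beta},$$ $$F_\alpha=\tfrac1{n(n-1)}(\delta^2A)_\alpha+\tfrac1{n-1}A_\alpha{}^{\mu\nu}(P^h_{\mu\nu}-P^A_{\mu\nu}).$$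 (ii) $A$ satisfies the Gauss equation $$2\,\mathrm{tf}\bigl(A_{\nu\gamma[\alpha}A_{\beta]\mu}{}^\nu\bigr)+W^h_{\alpha\beta\gamma\mu}=0\quad(n\ge4),$$ $$\nabla^h_{[\alpha}P^A_{\beta]\gamma}+\tfrac13A_{\mu\gamma[\alpha}(\delta A)_{\beta]}{}^\mu-Y_{\alpha\beta\gamma}=0\quad(n=3),$$ $$\nabla^h_\alpha|A|^2+2A_\alpha{}^{\mu\nu}(\delta A)_{\mu\nu}-8Y_{\alpha\mu}{}^\mu=0\quad(n=2),$$ and the Codazzi equation $$\nabla^h_{[\alpha}A_{\beta]\gamma\mu}-\tfrac1n\bigl(h_{\mu[\alpha}(\delta A)_{\beta]\gamma}+h_{\gamma[\alpha}(\delta A)_{\beta]\mu}\bigr)=0\quad(n\ge3),$$ $$\nabla^h_{[\alpha}(\delta^2A)_{\beta]}+4P^h_{\mu[\alpha}(\delta A)_{\beta]}{}^\mu-2A^{\gamma\mu}{}_{[\alpha}\nabla^h_{\beta]}P^h_{\gamma\mu}=0\quad(n=2).$$ -/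

import Mathlib

open scoped Manifold ContDiff

noncomputable section

namespace ConformalCodazzi

/-! ## Tensor calculus in a coordinate patch

Component functions are functions on `Coord n`, the model space `ℝⁿ` of an `n`-manifold.
`Comp1 n`, `Comp2 n`, `Comp3 n`, `Comp4 n` are systems of components with one to four indices.
All indices are lower unless stated otherwise; indices are raised with the inverse metric. -/

abbrev Coord (n : ℕ) := EuclideanSpace ℝ (Fin n)
abbrev Comp1 (n : ℕ) := Fin n → Coord n → ℝ
abbrev Comp2 (n : ℕ) := Fin n → Fin n → Coord n → ℝ
abbrev Comp3 (n : ℕ) := Fin n → Fin n → Fin n → Coord n → ℝ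
abbrev Comp4 (n : ℕ) := Fin n → Fin n → Fin n → Fin n → Coord n → ℝ

variable {n : ℕ}

/-- The partial derivative `∂ᵢ f`. -/
def pd (i : Fin n) (f : Coord n → ℝ) (y : Coord n) : ℝ :=
  fderiv ℝ f y (EuclideanSpace.single i 1)

/-- The skew part `T_{[ab]} = (T_{ab} - T_{ba}) / 2`. -/
def skew (T : Fin n → Fin n → ℝ) (a b : Fin n) : ℝ := (T a b - T b a) / 2

/-- The inverse metric `g^{ij}`. -/
def invMetric (g : Comp2 n) : Comp2 n := fun i j y =>
  (Matrix.of fun k l => g k l y)⁻¹ i j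

/-- The metric contraction `g^{ij} T_{ij}` at the point `y`. -/
def tr (g : Comp2 n) (y : Coord n) (T : Fin n → Fin n → ℝ) : ℝ :=
  ∑ i, ∑ j, invMetric g i j y * T i j

/-- The Christoffel symbol `Γ^k_{ij}` of the Levi-Civita connection. -/
def christoffel (g : Comp2 n) (k i j : Fin n) (y : Coord n) : ℝ :=
  (1 / 2) * ∑ l, invMetric g k l y * (pd i (g j l) y + pd j (g i l) y - pd l (g i j) y)

/-- `∇_a T_b`. -/
def nabla1 (g : Comp2 n) (T : Comp1 n) : Comp2 n := fun a b y =>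
  pd a (T b) y - ∑ m, christoffel g m a b y * T m y

/-- `∇_a T_{bc}`. -/
def nabla2 (g : Comp2 n) (T : Comp2 n) : Comp3 n := fun a b c y =>
  pd a (T b c) y - ∑ m, christoffel g m a b y * T m c y
    - ∑ m, christoffel g m a c y * T b m y

/-- `∇_a T_{bcd}`. -/
def nabla3 (g : Comp2 n) (T : Comp3 n) : Comp4 n := fun a b c d y =>
  pd a (T b c d) y - ∑ m, christoffel g m a b y * T m c d y
    - ∑ m, christoffel g m a c y * T b m d y - ∑ m, christoffel g m a d y * T b c m y

/-- `∇_a μ^b` for a vector field `μ`. -/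
def nablaVec (g : Comp2 n) (μ : Comp1 n) : Comp2 n := fun a b y =>
  pd a (μ b) y + ∑ m, christoffel g b a m y * μ m y

/-- The curvature `R_{ab}{}^c{}_d`, with `(∇_a ∇_b - ∇_b ∇_a) X^c = R_{ab}{}^c{}_d X^d`. -/
def riemann (g : Comp2 n) (a b c d : Fin n) (y : Coord n) : ℝ :=
  pd a (christoffel g c b d) y - pd b (christoffel g c a d) y
    + ∑ m, (christoffel g c a m y * christoffel g m b d y
      - christoffel g c b m y * christoffel g m a d y)

/-- `R_{abcd} = g_{cm} R_{ab}{}^m{}_d`. -/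
def riemannLow (g : Comp2 n) : Comp4 n := fun a b c d y =>
  ∑ m, g c m y * riemann g a b m d y

/-- `Ric_{bd} = R_{ab}{}^a{}_d`. -/
def ricci (g : Comp2 n) : Comp2 n := fun b d y => ∑ a, riemann g a b a d y

/-- The scalar curvature. -/
def scal (g : Comp2 n) (y : Coord n) : ℝ := tr g y fun b d => ricci g b d y

/-- The conformal Schouten tensor (meaningful for `n ≥ 3`). -/
def schouten (g : Comp2 n) : Comp2 n := fun a b y =>
  (1 / ((n : ℝ) - 2)) * (ricci g a b y - scal g y / (2 * ((n : ℝ) - 1)) * g a b y)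

/-- The Cotton tensor `Y_{abc} = ∇_{[a} P_{b]c}` of `P`. -/
def cotton (g P : Comp2 n) : Comp3 n := fun a b c y =>
  skew (fun a b => nabla2 g P a b c y) a b

/-- The Kulkarni-Nomizu type product `2 (g_{c[a} Q_{b]d} - g_{d[a} Q_{b]c})`. -/
def kn (g Q : Comp2 n) : Comp4 n := fun a b c d y =>
  2 * (skew (fun a b => g c a y * Q b d y) a b - skew (fun a b => g d a y * Q b c y) a b)

/-- The Weyl tensor `W_{abcd} = R_{abcd} - 2 (g_{c[a} P_{b]d} - g_{d[a} P_{b]c})`. -/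
def weyl (g P : Comp2 n) : Comp4 n := fun a b c d y =>
  riemannLow g a b c d y - kn g P a b c d y

/-- The Ricci contraction `g^{ac} X_{abcd}` of a four-index tensor. -/
def ricciOf (g : Comp2 n) (X : Comp4 n) : Comp2 n := fun b d y =>
  tr g y fun a c => X a b c d y

/-- The trace-free part of a tensor `X_{abcd}` with the symmetries of a curvature tensor, `n ≥ 3`:
the unique trace-free tensor of the form `X_{abcd} - 2 (g_{c[a} Q_{b]d} - g_{d[a} Q_{b]c})` with
`Q` symmetric. -/
def tfCurv (g : Comp2 n) (X : Comp4 n) : Comp4 n := fun a b c d y =>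
  X a b c d y - kn g (fun a b y => (1 / ((n : ℝ) - 2)) * (ricciOf g X a b y
    - (tr g y fun i j => ricciOf g X i j y) / (2 * ((n : ℝ) - 1)) * g a b y)) a b c d y

/-! ### The cubic form -/

/-- `(δA)_{ab} = ∇_c A_{ab}{}^c`. -/
def div1 (g : Comp2 n) (A : Comp3 n) : Comp2 n := fun a b y =>
  tr g y fun c d => nabla3 g A c a b d y

/-- `(δ²A)_a = ∇^b (δA)_{ab}`. -/
def div2 (g : Comp2 n) (A : Comp3 n) : Comp1 n := fun a y =>
  tr g y fun b c => nabla2 g (div1 g A) b a c y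

/-- `A_a{}^{μν} T_{μν}`. -/
def contract2 (g : Comp2 n) (A : Comp3 n) (T : Comp2 n) : Comp1 n := fun a y =>
  tr g y fun μ ρ => tr g y fun ν τ => A a μ ν y * T ρ τ y

/-- `A_{aμν} A_b{}^{μν}`. -/
def sqTensor (g : Comp2 n) (A : Comp3 n) : Comp2 n := fun a b y =>
  tr g y fun μ ρ => tr g y fun ν τ => A a μ ν y * A b ρ τ y

/-- `|A|² = A_{αμν} A^{αμν}`. -/
def normSq (g : Comp2 n) (A : Comp3 n) (y : Coord n) : ℝ :=
  tr g y fun a b => sqTensor g A a b y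

/-- The tensor `P^A_{ab}`. -/
def PA (g : Comp2 n) (A : Comp3 n) : Comp2 n := fun a b y =>
  if n = 2 then (1 / 4) * normSq g A y * g a b y
  else (1 / ((n : ℝ) - 2)) *
    (sqTensor g A a b y - normSq g A y / (2 * ((n : ℝ) - 1)) * g a b y)

/-- `2 A_{νc[a} A_{b]d}{}^ν`, with index order `a b c d`. -/
def cubicCurv (g : Comp2 n) (A : Comp3 n) : Comp4 n := fun a b c d y =>
  2 * skew (fun a b => tr g y fun ν τ => A ν c a y * A b d τ y) a b

/-! ### Tractors -/

/-- A tractor field over a coordinate patch, in the splitting given by the conformal scale: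
the components `(σ, μ^a, φ)`. -/
structure Tractor (n : ℕ) where
  σ : Coord n → ℝ
  μ : Comp1 n
  φ : Coord n → ℝ

/-- The tractor field is smooth on `U`. -/
def Tractor.SmoothOn (s : Tractor n) (U : Set (Coord n)) : Prop :=
  ContDiffOn ℝ ∞ s.σ U ∧ (∀ b, ContDiffOn ℝ ∞ (s.μ b) U) ∧ ContDiffOn ℝ ∞ s.φ U

/-- The conformal (for `n = 2`: Möbius) tractor connection in the direction `∂_a`:
`(∇_a σ - μ_a, ∇_a μ^b + δ_a^b φ + P_a{}^b σ, ∇_a φ - P_{ac} μ^c)`. -/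
def tractorNabla (g P : Comp2 n) (a : Fin n) (s : Tractor n) : Tractor n where
  σ y := pd a s.σ y - ∑ c, g a c y * s.μ c y
  μ b y := nablaVec g s.μ a b y + (if a = b then s.φ y else 0)
    + (∑ c, invMetric g b c y * P a c y) * s.σ y
  φ y := pd a s.φ y - ∑ c, P a c y * s.μ c y

/-- The endomorphism `Ã_a` of the tractor bundle:
`(0, E_a{}^b σ + A_{ac}{}^b μ^c, F_a σ + G_{ac} μ^c)`. -/
def tractorA (g E G : Comp2 n) (F : Comp1 n) (A : Comp3 n) (a : Fin n) (s : Tractor n) :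
    Tractor n where
  σ _ := 0
  μ b y := (∑ d, invMetric g b d y * E a d y) * s.σ y
    + ∑ c, (∑ d, invMetric g b d y * A a c d y) * s.μ c y
  φ y := F a y * s.σ y + ∑ c, G a c y * s.μ c y

/-- The connection `∇ - Ã` in the direction `∂_a`. -/
def modNabla (g P E G : Comp2 n) (F : Comp1 n) (A : Comp3 n) (a : Fin n) (s : Tractor n) :
    Tractor n where
  σ y := (tractorNabla g P a s).σ y - (tractorA g E G F A a s).σ y
  μ b y := (tractorNabla g P a s).μ b y - (tractorA g E G F A a s).μ b y
  φ y := (tractorNabla g P a s).φ y - (tractorA g E G F A a s).φ y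

/-- The connection `∇ - Ã` has vanishing curvature on `U`: its covariant derivatives along the
coordinate vector fields commute on all smooth tractor fields. -/
def FlatOn (g P E G : Comp2 n) (F : Comp1 n) (A : Comp3 n) (U : Set (Coord n)) : Prop :=
  ∀ s : Tractor n, s.SmoothOn U → ∀ a b : Fin n, ∀ y ∈ U,
    let D := modNabla g P E G F A
    (D a (D b s)).σ y = (D b (D a s)).σ y ∧
    (∀ c, (D a (D b s)).μ c y = (D b (D a s)).μ c y) ∧
    (D a (D b s)).φ y = (D b (D a s)).φ y

/-! ### The two conditions, in a coordinate patch -/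

/-- The formulas for `E`, `G` and `F` on `U`. -/
def FormulasOn (g P E G : Comp2 n) (F : Comp1 n) (A : Comp3 n) (U : Set (Coord n)) : Prop :=
  ∀ y ∈ U,
    (∀ a b, E a b y = -(1 / (n : ℝ)) * div1 g A a b y + PA g A a b y) ∧
    (∀ a b, G a b y = -(1 / (n : ℝ)) * div1 g A a b y - PA g A a b y) ∧
    (∀ a, F a y = 1 / ((n : ℝ) * ((n : ℝ) - 1)) * div2 g A a y
      + 1 / ((n : ℝ) - 1) * contract2 g A (fun μ ν y => P μ ν y - PA g A μ ν y) a y)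

/-- The Gauss equation for `n ≥ 4`. -/
def Gauss4On (g P : Comp2 n) (A : Comp3 n) (U : Set (Coord n)) : Prop :=
  ∀ y ∈ U, ∀ a b c d, tfCurv g (cubicCurv g A) a b c d y + weyl g P a b c d y = 0

/-- The Gauss equation for `n = 3`. -/
def Gauss3On (g P : Comp2 n) (A : Comp3 n) (U : Set (Coord n)) : Prop :=
  ∀ y ∈ U, ∀ a b c,
    skew (fun a b => nabla2 g (PA g A) a b c y) a b
      + (1 / 3) * skew (fun a b => tr g y fun μ ν => A μ c a y * div1 g A b ν y) a b
      - cotton g P a b c y = 0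

/-- The Gauss equation for `n = 2`. -/
def Gauss2On (g P : Comp2 n) (A : Comp3 n) (U : Set (Coord n)) : Prop :=
  ∀ y ∈ U, ∀ a,
    pd a (normSq g A) y + 2 * contract2 g A (div1 g A) a y
      - 8 * (tr g y fun μ ν => cotton g P a μ ν y) = 0

/-- The Codazzi equation for `n ≥ 3`. -/
def Codazzi3On (g : Comp2 n) (A : Comp3 n) (U : Set (Coord n)) : Prop :=
  ∀ y ∈ U, ∀ a b c d,
    skew (fun a b => nabla3 g A a b c d y) a b
      - (1 / (n : ℝ)) * (skew (fun a b => g d a y * div1 g A b c y) a b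
        + skew (fun a b => g c a y * div1 g A b d y) a b) = 0

/-- The Codazzi equation for `n = 2`. -/
def Codazzi2On (g P : Comp2 n) (A : Comp3 n) (U : Set (Coord n)) : Prop :=
  ∀ y ∈ U, ∀ a b,
    skew (fun a b => nabla1 g (div2 g A) a b y) a b
      + 4 * skew (fun a b => tr g y fun μ ν => P μ a y * div1 g A b ν y) a b
      - 2 * skew (fun a b => contract2 g (fun a μ ν y => A μ ν a y)
          (fun μ ν y => nabla2 g P b μ ν y) a y) a b = 0

/-! ## Tensor fields on a manifold -/

section Manifold

variable {M : Type*} [TopologicalSpace M] [ChartedSpace (Coord n) M]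

/-- The smooth charts of `M`. -/
def charts (n : ℕ) (M : Type*) [TopologicalSpace M] [ChartedSpace (Coord n) M] :
    Set (OpenPartialHomeomorph M (Coord n)) :=
  IsManifold.maximalAtlas (𝓡 n) ∞ M

/-- The coordinate vector field `∂ᵢ` of the chart `e`, at the point with coordinates `y`. -/
def coordVec (e : OpenPartialHomeomorph M (Coord n)) (i : Fin n) (y : Coord n) :
    TangentSpace (𝓡 n) (e.symm y) :=
  mfderiv (𝓡 n) (𝓡 n) e.symm y
    (show TangentSpace (𝓡 n) y from (EuclideanSpace.single i (1 : ℝ) : Coord n))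

/-- A smooth Riemannian metric on `M`. -/
abbrev Metric (n : ℕ) (M : Type*) [TopologicalSpace M] [ChartedSpace (Coord n) M]
    [IsManifold (𝓡 n) ∞ M] :=
  Bundle.ContMDiffRiemannianMetric (𝓡 n) ∞ (Coord n) (fun x : M => TangentSpace (𝓡 n) x)

/-- The components `h_{ij}` of a metric in a chart. -/
def Metric.comp [IsManifold (𝓡 n) ∞ M] (h : Metric n M)
    (e : OpenPartialHomeomorph M (Coord n)) : Comp2 n := fun i j y =>
  h.inner (e.symm y) (coordVec e i y) (coordVec e j y)

/-- A smooth covariant tensor field of rank `k`: a multilinear form on each tangent space, whose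
components in every chart are smooth. -/
structure CovTensor (n : ℕ) (M : Type*) [TopologicalSpace M] [ChartedSpace (Coord n) M]
    (k : ℕ) where
  toFun : ∀ x : M, MultilinearMap ℝ (fun _ : Fin k => TangentSpace (𝓡 n) x) ℝ
  smooth : ∀ e ∈ charts n M, ∀ i : Fin k → Fin n,
    ContDiffOn ℝ ∞ (fun y => toFun (e.symm y) fun j => coordVec e (i j) y) e.target

/-- The tensor field is totally symmetric. -/
def CovTensor.IsSymm {k : ℕ} (T : CovTensor n M k) : Prop :=
  ∀ (x : M) (π : Equiv.Perm (Fin k)) (v : Fin k → TangentSpace (𝓡 n) x),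
    T.toFun x (fun j => v (π j)) = T.toFun x v

def CovTensor.comp1 (T : CovTensor n M 1) (e : OpenPartialHomeomorph M (Coord n)) : Comp1 n :=
  fun a y => T.toFun (e.symm y) fun j => coordVec e (![a] j) y

def CovTensor.comp2 (T : CovTensor n M 2) (e : OpenPartialHomeomorph M (Coord n)) : Comp2 n :=
  fun a b y => T.toFun (e.symm y) fun j => coordVec e (![a, b] j) y

def CovTensor.comp3 (T : CovTensor n M 3) (e : OpenPartialHomeomorph M (Coord n)) : Comp3 n :=
  fun a b c y => T.toFun (e.symm y) fun j => coordVec e (![a, b, c] j) y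

variable [IsManifold (𝓡 n) ∞ M]

/-- `h^{ab} A_{abc} = 0`. -/
def TraceFree3 (h : Metric n M) (A : CovTensor n M 3) : Prop :=
  ∀ e ∈ charts n M, ∀ y ∈ e.target, ∀ c,
    (tr (h.comp e) y fun a b => A.comp3 e a b c y) = 0

/-- `E_c{}^c + G_c{}^c = 0`. -/
def TraceSumZero (h : Metric n M) (E G : CovTensor n M 2) : Prop :=
  ∀ e ∈ charts n M, ∀ y ∈ e.target,
    (tr (h.comp e) y fun a b => E.comp2 e a b y) + (tr (h.comp e) y fun a b => G.comp2 e a b y) = 0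

/-- `tf (E_{ab} - G_{ab}) = 0`, where `tf T_{ab} = T_{ab} - (1/n) T_c{}^c h_{ab}`. -/
def TfDiffZero (h : Metric n M) (E G : CovTensor n M 2) : Prop :=
  ∀ e ∈ charts n M, ∀ y ∈ e.target, ∀ a b,
    (E.comp2 e a b y - G.comp2 e a b y)
      - (1 / (n : ℝ)) * (tr (h.comp e) y fun c d => E.comp2 e c d y - G.comp2 e c d y)
        * h.comp e a b y = 0

/-- `ℙ` represents a Möbius structure in the scale `h`: it is symmetric and `ℙ_a{}^a = scal / 2`.
(Its representatives in the other conformal scales are then given by the transformation law.) -/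
def IsMobius (h : Metric n M) (ℙ : CovTensor n M 2) : Prop :=
  ℙ.IsSymm ∧ ∀ e ∈ charts n M, ∀ y ∈ e.target,
    (tr (h.comp e) y fun a b => ℙ.comp2 e a b y) = (1 / 2) * scal (h.comp e) y

/-- `P^h_{ab}`: the Schouten tensor of `h` if `n ≥ 3`, the Möbius tensor `ℙ` if `n = 2`. -/
def rho (h : Metric n M) (ℙ : CovTensor n M 2) (e : OpenPartialHomeomorph M (Coord n)) :
    Comp2 n :=
  if n = 2 then ℙ.comp2 e else schouten (h.comp e)

/-- The connection `∇ - Ã` on the conformal (Möbius) tractor bundle is flat. -/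
def IsFlat (h : Metric n M) (ℙ E G : CovTensor n M 2) (F : CovTensor n M 1)
    (A : CovTensor n M 3) : Prop :=
  ∀ e ∈ charts n M, FlatOn (h.comp e) (rho h ℙ e) (E.comp2 e) (G.comp2 e) (F.comp1 e)
    (A.comp3 e) e.target

/-- `E`, `G`, `F` are given by the explicit formulas in `A`, `δA`, `P^h` and `P^A`. -/
def Formulas (h : Metric n M) (ℙ E G : CovTensor n M 2) (F : CovTensor n M 1)
    (A : CovTensor n M 3) : Prop :=
  ∀ e ∈ charts n M, FormulasOn (h.comp e) (rho h ℙ e) (E.comp2 e) (G.comp2 e) (F.comp1 e)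
    (A.comp3 e) e.target

/-- The Gauss equation. -/
def GaussEq (h : Metric n M) (ℙ : CovTensor n M 2) (A : CovTensor n M 3) : Prop :=
  ∀ e ∈ charts n M,
    (4 ≤ n → Gauss4On (h.comp e) (rho h ℙ e) (A.comp3 e) e.target) ∧
    (n = 3 → Gauss3On (h.comp e) (rho h ℙ e) (A.comp3 e) e.target) ∧
    (n = 2 → Gauss2On (h.comp e) (rho h ℙ e) (A.comp3 e) e.target)

/-- The Codazzi equation. -/
def CodazziEq (h : Metric n M) (ℙ : CovTensor n M 2) (A : CovTensor n M 3) : Prop :=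
  ∀ e ∈ charts n M,
    (3 ≤ n → Codazzi3On (h.comp e) (A.comp3 e) e.target) ∧
    (n = 2 → Codazzi2On (h.comp e) (rho h ℙ e) (A.comp3 e) e.target)

end Manifold

end ConformalCodazzi

end

/-! ### Metric components in a chart -/

namespace ConformalCodazzi

variable {n : ℕ} {M : Type*} [TopologicalSpace M] [ChartedSpace (Coord n) M]

/-! In a chart the connection is `∂_a + M_a` acting on columns `(σ, μ, φ)`, so flatness means that
the matrix curvature `K_ab` vanishes. Symmetry of `g`, `P`, `E`, `G`, `A` and the Levi-Civita
properties kill every entry of `K` except `μ → μ`, `σ → μ`, `μ → φ` and `σ → φ`.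

Put `N = (E + G)/2` and `V = (E - G)/2`. With indices lowered, the `μ → μ` entry splits into a part
skew in the endomorphism indices, built from the Weyl tensor, `V` and the commutator of `A` with
itself (`gaussTensor`), and a symmetric part, built from the skew derivative of `A` and `N`
(`codazziTensor`). Their contractions force `V = P^A` and `N = -δA/n`; for `n = 2` the contraction
sees only the trace of `V`, and the hypothesis on `tf (E - G)` supplies the rest. The trace-free
remainders are the Gauss equation for `n ≥ 4` and the Codazzi equation for `n ≥ 3`; in lower
dimensions they vanish by linear algebra.

Half the sum of the entries `σ → μ` and `μ → φ` (`curvMean`) has a contraction in which `F` appears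
with coefficient `n - 1`, and this fixes `F`. Half their difference is `curvDev`.

For the converse the Bianchi identity does the work. Once the `μ → μ` entry vanishes on the whole
patch, the identity in that entry is algebraic in the other entries: `curvMean` vanishes as soon as
its trace does (`curvVec_add_curvForm_eq_zero`), and for `n ≥ 4` so does `curvDev`
(`curvVec_eq_zero`). For `n = 3`, `curvDev = 0` is exactly the Gauss equation. For `n ≥ 3` the
identity in the entry `σ → μ` then removes `σ → φ` (`curvScal_eq_zero`). For `n = 2` the mixed
entries are determined by their traces, the trace of `curvDev` being the Gauss equation, and the
entry `σ → φ` is the Codazzi equation (`curvScal_eq_of_two`). -/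

theorem mdifferentiable_of_mem_charts {e : OpenPartialHomeomorph M (Coord n)}
    (he : e ∈ charts n M) : e.MDifferentiable (𝓡 n) (𝓡 n) := by
  refine ⟨(contMDiffOn_of_mem_maximalAtlas he).mdifferentiableOn (by simp),
    (contMDiffOn_symm_of_mem_maximalAtlas he).mdifferentiableOn (by simp)⟩

theorem contMDiff_const_section (c : EuclideanSpace ℝ (Fin n)) :
    ContMDiff (𝓡 n) (𝓡 n).tangent ∞
      (fun y : EuclideanSpace ℝ (Fin n) => (⟨y, c⟩ : TangentBundle (𝓡 n) (EuclideanSpace ℝ (Fin n)))) := by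
  intro y
  refine (Bundle.contMDiffAt_section (F := EuclideanSpace ℝ (Fin n))
    (E := fun x : EuclideanSpace ℝ (Fin n) => TangentSpace (𝓡 n) x) (s := fun _ => c) (x₀ := y)).2 ?_
  have : ContMDiffAt (𝓡 n) 𝓘(ℝ, EuclideanSpace ℝ (Fin n)) ∞
    (fun _ : EuclideanSpace ℝ (Fin n) => c) y := contMDiffAt_const
  refine this.congr_of_eventuallyEq (Filter.Eventually.of_forall fun z => ?_)
  simp

variable [IsManifold (𝓡 n) ∞ M]

/-- The coordinate field is the image of a constant section under the tangent map of the inverse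
chart, and both are smooth. -/
theorem contMDiffOn_coordVec {e : OpenPartialHomeomorph M (Coord n)} (he : e ∈ charts n M)
    (i : Fin n) : ContMDiffOn (𝓡 n) ((𝓡 n).prod 𝓘(ℝ, Coord n)) ∞
      (fun y => Bundle.TotalSpace.mk' (Coord n) (E := fun x : M => TangentSpace (𝓡 n) x)
        (e.symm y) (coordVec e i y)) e.target := by
  have h1 := (contMDiffOn_symm_of_mem_maximalAtlas he).contMDiffOn_tangentMapWithin
    (m := ∞) (by simp) e.open_target.uniqueMDiffOn
  have h2 := contMDiff_const_section (EuclideanSpace.single i (1 : ℝ))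
  have h3 := h1.comp (h2.contMDiffOn (s := e.target)) (fun y hy => hy)
  refine h3.congr fun y hy => ?_
  simp only [Function.comp, tangentMapWithin, mfderivWithin_of_isOpen e.open_target hy]
  rfl

theorem contDiffOn_metricComp (h : Metric n M) {e : OpenPartialHomeomorph M (Coord n)}
    (he : e ∈ charts n M) (i j : Fin n) : ContDiffOn ℝ ∞ (h.comp e i j) e.target := by
  rw [← contMDiffOn_iff_contDiffOn]
  have hb := contMDiffOn_symm_of_mem_maximalAtlas he
  have := ContMDiffOn.clm_bundle_apply₂ (F₁ := Coord n) (F₂ := Coord n)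
    (F₃ := ℝ) (E₃ := Bundle.Trivial M ℝ)
    (h.contMDiff.contMDiffOn (s := Set.univ) |>.comp hb (fun y _ => Set.mem_univ _)) (contMDiffOn_coordVec he i)
    (contMDiffOn_coordVec he j)
  intro y hy
  have h4 := this y hy
  rw [Bundle.contMDiffWithinAt_totalSpace] at h4
  exact h4.2

theorem metricComp_symm (h : Metric n M) (e : OpenPartialHomeomorph M (Coord n)) (i j : Fin n)
    (y : Coord n) : h.comp e i j y = h.comp e j i y :=
  h.symm _ _ _

/-- The components form the Gram matrix of the coordinate frame: its quadratic form at `x` is `h(v,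
v)` with `v = ∑ xᵢ ∂ᵢ`, and `v ≠ 0` because the inverse chart has injective derivative. -/
theorem metricComp_posDef (h : Metric n M) {e : OpenPartialHomeomorph M (Coord n)}
    (he : e ∈ charts n M) {y : Coord n} (hy : y ∈ e.target) :
    (Matrix.of fun k l => h.comp e k l y).PosDef := by
  rw [Matrix.posDef_iff_dotProduct_mulVec]
  refine ⟨by ext i j; simp [Matrix.conjTranspose, metricComp_symm h e i j], fun {x} hx => ?_⟩
  set L := mfderiv (𝓡 n) (𝓡 n) e.symm y
  have hinj : Function.Injective L := (mdifferentiable_of_mem_charts he).symm.mfderiv_injective hy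
  let v : TangentSpace (𝓡 n) (e.symm y) := ∑ i, x i • coordVec e i y
  have hv : v = L (show TangentSpace (𝓡 n) y from (WithLp.toLp 2 x : Coord n)) := by
    have hx' : (WithLp.toLp 2 x : Coord n)
        = ∑ i, x i • (EuclideanSpace.single i (1 : ℝ) : Coord n) := by
      ext j; simp [Finset.sum_apply, Pi.single_apply]
    rw [hx']
    exact (map_sum L _ _).symm ▸ Finset.sum_congr rfl fun i _ => (map_smul L _ _).symm
  have hv0 : v ≠ 0 := by
    rw [hv]
    intro h0
    have := hinj (h0.trans (map_zero L).symm)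
    apply hx
    have h5 : (WithLp.toLp 2 x : Coord n) = 0 := this
    simpa using h5
  have hL : ∀ w : TangentSpace (𝓡 n) (e.symm y), h.inner (e.symm y) v w
      = ∑ i, x i * h.inner (e.symm y) (coordVec e i y) w := fun w => by
    rw [show h.inner (e.symm y) v = ∑ i, x i • h.inner (e.symm y) (coordVec e i y) by
      simp only [v, map_sum, map_smul], sum_apply]
    rfl
  have hR : ∀ i, h.inner (e.symm y) (coordVec e i y) v
      = ∑ j, x j * h.comp e i j y := fun i => by
    simp only [v, map_sum, map_smul, smul_eq_mul]; rfl
  have hpos := h.pos _ v hv0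
  rw [hL v] at hpos
  refine lt_of_lt_of_eq hpos ?_
  simp only [dotProduct, Matrix.mulVec, Matrix.of_apply, star_trivial]
  refine Finset.sum_congr rfl fun i _ => congrArg _ ?_
  rw [hR i]
  exact Finset.sum_congr rfl fun j _ => mul_comm _ _
end ConformalCodazzi

/-! ### Partial derivatives -/

namespace ConformalCodazzi

section PartialDerivatives

variable {n : ℕ} {U : Set (Coord n)} {y : Coord n}

theorem pd_add {f g : Coord n → ℝ} (a : Fin n) (hf : DifferentiableAt ℝ f y)
    (hg : DifferentiableAt ℝ g y) : pd a (fun z => f z + g z) y = pd a f y + pd a g y := by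
  simp [pd, fderiv_fun_add hf hg]

theorem pd_sub {f g : Coord n → ℝ} (a : Fin n) (hf : DifferentiableAt ℝ f y)
    (hg : DifferentiableAt ℝ g y) : pd a (fun z => f z - g z) y = pd a f y - pd a g y := by
  simp [pd, fderiv_fun_sub hf hg]

theorem pd_neg {f : Coord n → ℝ} (a : Fin n) : pd a (fun z => -f z) y = -pd a f y := by
  simp [pd, fderiv_fun_neg]

theorem pd_mul {f g : Coord n → ℝ} (a : Fin n) (hf : DifferentiableAt ℝ f y)
    (hg : DifferentiableAt ℝ g y) :
    pd a (fun z => f z * g z) y = pd a f y * g y + f y * pd a g y := by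
  simp [pd, fderiv_fun_mul hf hg]; ring

theorem pd_const_mul {f : Coord n → ℝ} (a : Fin n) (c : ℝ) (hf : DifferentiableAt ℝ f y) :
    pd a (fun z => c * f z) y = c * pd a f y := by
  simp [pd, fderiv_const_mul hf]

theorem pd_const (a : Fin n) (c : ℝ) : pd a (fun _ => c) y = 0 := by
  simp [pd]

theorem pd_sum {ι : Type*} (s : Finset ι) {f : ι → Coord n → ℝ} (a : Fin n)
    (hf : ∀ i ∈ s, DifferentiableAt ℝ (f i) y) :
    pd a (fun z => ∑ i ∈ s, f i z) y = ∑ i ∈ s, pd a (f i) y := by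
  simp [pd, fderiv_fun_sum hf, sum_apply]

theorem pd_congr {f g : Coord n → ℝ} (a : Fin n) (hU : IsOpen U) (hy : y ∈ U)
    (h : ∀ z ∈ U, f z = g z) : pd a f y = pd a g y := by
  have : f =ᶠ[nhds y] g := Filter.eventuallyEq_of_mem (hU.mem_nhds hy) h
  simp [pd, this.fderiv_eq]

theorem differentiableAt_of_smooth {f : Coord n → ℝ} (hU : IsOpen U) (hy : y ∈ U)
    (hf : ContDiffOn ℝ ∞ f U) : DifferentiableAt ℝ f y :=
  (hf.contDiffAt (hU.mem_nhds hy)).differentiableAt (by simp)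

theorem contDiffOn_pd {f : Coord n → ℝ} (a : Fin n) (hU : IsOpen U)
    (hf : ContDiffOn ℝ ∞ f U) : ContDiffOn ℝ ∞ (pd a f) U :=
  (hf.fderiv_of_isOpen hU (m := ∞) (by simp)).clm_apply contDiffOn_const

theorem pd_comm {f : Coord n → ℝ} (a b : Fin n) (hU : IsOpen U) (hy : y ∈ U)
    (hf : ContDiffOn ℝ ∞ f U) : pd a (pd b f) y = pd b (pd a f) y := by
  have hd : DifferentiableAt ℝ (fderiv ℝ f) y :=
    ((hf.fderiv_of_isOpen hU (m := ∞) (by simp)).contDiffAt (hU.mem_nhds hy)).differentiableAt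
      (by simp)
  have hs : IsSymmSndFDerivAt ℝ f y :=
    (hf.contDiffAt (hU.mem_nhds hy)).isSymmSndFDerivAt
      (by simpa using (WithTop.coe_le_coe.2 (le_top : (2 : ℕ∞) ≤ ⊤)))
  have key : ∀ i j : Fin n, pd i (pd j f) y
      = fderiv ℝ (fderiv ℝ f) y (EuclideanSpace.single i 1) (EuclideanSpace.single j 1) := by
    intro i j
    change fderiv ℝ (fun z => fderiv ℝ f z (EuclideanSpace.single j 1)) y _ = _
    rw [fderiv_clm_apply hd (differentiableAt_const _)]
    simp
  rw [key, key, hs]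

end PartialDerivatives

/-! ### Curvature of a matrix-valued connection -/

section MatrixDerivatives

variable {n : ℕ} {U : Set (Coord n)} {y : Coord n} {ι κ τ : Type*}

/-- The entrywise partial derivative of a matrix-valued function. -/
noncomputable def pdM (a : Fin n) (M : Coord n → Matrix ι κ ℝ) (y : Coord n) : Matrix ι κ ℝ :=
  Matrix.of fun i j => pd a (fun z => M z i j) y

/-- All entries of the matrix-valued function are smooth on `U`. -/
def SmoothMat (M : Coord n → Matrix ι κ ℝ) (U : Set (Coord n)) : Prop :=
  ∀ i j, ContDiffOn ℝ ∞ (fun z => M z i j) U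

theorem SmoothMat.pdM {M : Coord n → Matrix ι κ ℝ} (hM : SmoothMat M U) (hU : IsOpen U)
    (a : Fin n) : SmoothMat (pdM a M) U :=
  fun i j => contDiffOn_pd a hU (hM i j)

theorem SmoothMat.sub {M N : Coord n → Matrix ι κ ℝ} (hM : SmoothMat M U) (hN : SmoothMat N U) :
    SmoothMat (fun z => M z - N z) U :=
  fun i j => (hM i j).sub (hN i j)

theorem SmoothMat.mul [Fintype κ] {M : Coord n → Matrix ι κ ℝ} {N : Coord n → Matrix κ τ ℝ}
    (hM : SmoothMat M U) (hN : SmoothMat N U) : SmoothMat (fun z => M z * N z) U :=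
  fun i j => by
    simp only [Matrix.mul_apply]
    exact ContDiffOn.sum fun k _ => (hM i k).mul (hN k j)

theorem pdM_add {M N : Coord n → Matrix ι κ ℝ} (a : Fin n) (hU : IsOpen U) (hy : y ∈ U)
    (hM : SmoothMat M U) (hN : SmoothMat N U) :
    pdM a (fun z => M z + N z) y = pdM a M y + pdM a N y := by
  ext i j
  exact pd_add a (differentiableAt_of_smooth hU hy (hM i j))
    (differentiableAt_of_smooth hU hy (hN i j))

theorem pdM_sub {M N : Coord n → Matrix ι κ ℝ} (a : Fin n) (hU : IsOpen U) (hy : y ∈ U)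
    (hM : SmoothMat M U) (hN : SmoothMat N U) :
    pdM a (fun z => M z - N z) y = pdM a M y - pdM a N y := by
  ext i j
  exact pd_sub a (differentiableAt_of_smooth hU hy (hM i j))
    (differentiableAt_of_smooth hU hy (hN i j))

theorem pdM_mul [Fintype κ] {M : Coord n → Matrix ι κ ℝ} {N : Coord n → Matrix κ τ ℝ}
    (a : Fin n) (hU : IsOpen U) (hy : y ∈ U) (hM : SmoothMat M U) (hN : SmoothMat N U) :
    pdM a (fun z => M z * N z) y = pdM a M y * N y + M y * pdM a N y := by
  ext i j
  have hMd := fun k => differentiableAt_of_smooth hU hy (hM i k)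
  have hNd := fun k => differentiableAt_of_smooth hU hy (hN k j)
  simp only [pdM, Matrix.of_apply, Matrix.add_apply, Matrix.mul_apply]
  rw [pd_sum _ _ fun k _ => (hMd k).fun_mul (hNd k), ← Finset.sum_add_distrib]
  exact Finset.sum_congr rfl fun k _ => pd_mul a (hMd k) (hNd k)

theorem pdM_comm {M : Coord n → Matrix ι κ ℝ} (a b : Fin n) (hU : IsOpen U) (hy : y ∈ U)
    (hM : SmoothMat M U) : pdM a (pdM b M) y = pdM b (pdM a M) y := by
  ext i j
  exact pd_comm a b hU hy (hM i j)

theorem pdM_congr {M N : Coord n → Matrix ι κ ℝ} (a : Fin n) (hU : IsOpen U) (hy : y ∈ U)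
    (h : ∀ z ∈ U, M z = N z) : pdM a M y = pdM a N y := by
  ext i j
  exact pd_congr a hU hy fun z hz => by rw [h z hz]

theorem pdM_const (a : Fin n) (C : Matrix ι κ ℝ) : pdM a (fun _ => C) y = 0 := by
  ext i j
  exact pd_const a _

/-- The curvature `∂_a M_b - ∂_b M_a + M_a M_b - M_b M_a` of the connection `∂_a + M_a`. -/
noncomputable def curvMat [Fintype ι] (M : Fin n → Coord n → Matrix ι ι ℝ) (a b : Fin n) (y : Coord n) :
    Matrix ι ι ℝ :=
  pdM a (M b) y - pdM b (M a) y + (M a y * M b y - M b y * M a y)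

theorem curvMat_skew [Fintype ι] (M : Fin n → Coord n → Matrix ι ι ℝ) (a b : Fin n)
    (y : Coord n) : curvMat M a b y = -curvMat M b a y := by
  simp only [curvMat]; abel

/-- The covariant derivatives `∂_a + M_a` commute up to the curvature. -/
theorem commutator_eq_curvMat [Fintype ι] {M : Fin n → Coord n → Matrix ι ι ℝ} (hU : IsOpen U)
    (hy : y ∈ U) (hM : ∀ a, SmoothMat (M a) U) {S : Coord n → Matrix ι κ ℝ} (hS : SmoothMat S U)
    (a b : Fin n) :
    (pdM a (fun z => pdM b S z + M b z * S z) y + M a y * (pdM b S y + M b y * S y))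
      - (pdM b (fun z => pdM a S z + M a z * S z) y + M b y * (pdM a S y + M a y * S y))
      = curvMat M a b y * S y := by
  rw [pdM_add a hU hy (hS.pdM hU b) ((hM b).mul hS), pdM_add b hU hy (hS.pdM hU a) ((hM a).mul hS),
    pdM_mul a hU hy (hM b) hS, pdM_mul b hU hy (hM a) hS, pdM_comm a b hU hy hS, curvMat]
  simp only [Matrix.mul_add, Matrix.add_mul, Matrix.sub_mul, Matrix.mul_assoc]
  abel

/-- The Bianchi identity for the connection `∂_a + M_a`. -/
theorem bianchi_curvMat [Fintype ι] {M : Fin n → Coord n → Matrix ι ι ℝ} (hU : IsOpen U)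
    (hy : y ∈ U) (hM : ∀ a, SmoothMat (M a) U) (a b e : Fin n) :
    (pdM e (curvMat M a b) y + M e y * curvMat M a b y - curvMat M a b y * M e y)
      + (pdM a (curvMat M b e) y + M a y * curvMat M b e y - curvMat M b e y * M a y)
      + (pdM b (curvMat M e a) y + M b y * curvMat M e a y - curvMat M e a y * M b y) = 0 := by
  have key : ∀ c p q : Fin n, pdM c (curvMat M p q) y
      = pdM c (pdM p (M q)) y - pdM c (pdM q (M p)) y
        + ((pdM c (M p) y * M q y + M p y * pdM c (M q) y)
          - (pdM c (M q) y * M p y + M q y * pdM c (M p) y)) := by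
    intro c p q
    have h1 := ((hM q).pdM hU p).sub ((hM p).pdM hU q)
    have h2 := (hM p).mul (hM q)
    have h3 := (hM q).mul (hM p)
    change pdM c (fun z => (pdM p (M q) z - pdM q (M p) z)
      + (M p z * M q z - M q z * M p z)) y = _
    rw [pdM_add c hU hy h1 (h2.sub h3), pdM_sub c hU hy ((hM q).pdM hU p) ((hM p).pdM hU q),
      pdM_sub c hU hy h2 h3, pdM_mul c hU hy (hM p) (hM q), pdM_mul c hU hy (hM q) (hM p)]
  -- Once the second partial derivatives are commuted, the cyclic sum cancels as a noncommutative
  -- polynomial identity.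
  rw [key, key, key, pdM_comm e a hU hy (hM b), pdM_comm e b hU hy (hM a),
    pdM_comm a b hU hy (hM e)]
  simp only [curvMat]
  noncomm_ring

end MatrixDerivatives

end ConformalCodazzi

/-! ### The metric, its inverse and the Levi-Civita connection -/

namespace ConformalCodazzi

variable {n : ℕ} {U : Set (Coord n)} {y : Coord n} {g : Comp2 n}

/-- `g` is the system of components of a smooth Riemannian metric on the open set `U`. -/
structure IsMetricOn (g : Comp2 n) (U : Set (Coord n)) : Prop where
  isOpen : IsOpen U
  smooth : ∀ i j, ContDiffOn ℝ ∞ (g i j) U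
  symm : ∀ i j y, g i j y = g j i y
  posDef : ∀ y ∈ U, (Matrix.of fun k l => g k l y).PosDef

/-- The matrix of the metric. -/
def gMat (g : Comp2 n) (y : Coord n) : Matrix (Fin n) (Fin n) ℝ := Matrix.of fun k l => g k l y

/-- The matrix of the inverse metric. -/
noncomputable def invMat (g : Comp2 n) (y : Coord n) : Matrix (Fin n) (Fin n) ℝ := (gMat g y)⁻¹

/-- The matrix `(k, j) ↦ Γ^k_{aj}`. -/
noncomputable def chrMat (g : Comp2 n) (a : Fin n) (y : Coord n) : Matrix (Fin n) (Fin n) ℝ :=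
  Matrix.of fun k j => christoffel g k a j y

theorem invMetric_eq (g : Comp2 n) (i j : Fin n) (y : Coord n) :
    invMetric g i j y = invMat g y i j := rfl

section TraceAlgebra

theorem tr_add (S T : Fin n → Fin n → ℝ) :
    tr g y (fun i j => S i j + T i j) = tr g y (fun i j => S i j) + tr g y fun i j => T i j := by
  simp only [tr, mul_add, Finset.sum_add_distrib]

theorem tr_sub (S T : Fin n → Fin n → ℝ) :
    tr g y (fun i j => S i j - T i j) = tr g y (fun i j => S i j) - tr g y fun i j => T i j := by
  simp only [tr, mul_sub, Finset.sum_sub_distrib]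

theorem tr_neg (T : Fin n → Fin n → ℝ) :
    tr g y (fun i j => -T i j) = -tr g y fun i j => T i j := by
  simp only [tr, mul_neg, Finset.sum_neg_distrib]

theorem tr_zero : tr g y (fun _ _ => 0) = 0 := by
  simp [tr]

theorem tr_mul_left (c : ℝ) (T : Fin n → Fin n → ℝ) :
    tr g y (fun i j => c * T i j) = c * tr g y fun i j => T i j := by
  simp only [tr, Finset.mul_sum]
  exact Finset.sum_congr rfl fun i _ => Finset.sum_congr rfl fun j _ => by ring

theorem tr_mul_right (c : ℝ) (T : Fin n → Fin n → ℝ) :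
    tr g y (fun i j => T i j * c) = (tr g y fun i j => T i j) * c := by
  simp only [mul_comm _ c, tr_mul_left]

theorem tr_eq_sum_prod (T : Fin n → Fin n → ℝ) :
    tr g y T = ∑ p : Fin n × Fin n, invMetric g p.1 p.2 y * T p.1 p.2 := by
  rw [Fintype.sum_prod_type]; rfl

theorem tr_sum {ι : Type*} (s : Finset ι) (T : ι → Fin n → Fin n → ℝ) :
    tr g y (fun i j => ∑ m ∈ s, T m i j) = ∑ m ∈ s, tr g y fun i j => T m i j := by
  simp only [tr_eq_sum_prod, Finset.mul_sum]
  exact Finset.sum_comm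

theorem tr_comm (X : Fin n → Fin n → Fin n → Fin n → ℝ) :
    tr g y (fun i j => tr g y fun k l => X i j k l)
      = tr g y fun k l => tr g y fun i j => X i j k l := by
  simp only [tr_eq_sum_prod, Finset.mul_sum]
  rw [Finset.sum_comm]
  exact Finset.sum_congr rfl fun p _ => Finset.sum_congr rfl fun q _ => by ring

end TraceAlgebra

namespace IsMetricOn

theorem gMat_transpose (hg : IsMetricOn g U) (y : Coord n) : (gMat g y).transpose = gMat g y := by
  ext i j; exact hg.symm j i y

theorem invMat_transpose (hg : IsMetricOn g U) (y : Coord n) :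
    (invMat g y).transpose = invMat g y := by
  rw [invMat, Matrix.transpose_nonsing_inv, hg.gMat_transpose]

theorem invMetric_symm (hg : IsMetricOn g U) (i j : Fin n) (y : Coord n) :
    invMetric g i j y = invMetric g j i y :=
  congrFun (congrFun (hg.invMat_transpose y) j) i

theorem isUnit_det (hg : IsMetricOn g U) (hy : y ∈ U) : IsUnit (gMat g y).det :=
  (hg.posDef y hy).det_pos.ne'.isUnit

theorem gMat_mul_invMat (hg : IsMetricOn g U) (hy : y ∈ U) : gMat g y * invMat g y = 1 :=
  Matrix.mul_nonsing_inv _ (hg.isUnit_det hy)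

theorem invMat_mul_gMat (hg : IsMetricOn g U) (hy : y ∈ U) : invMat g y * gMat g y = 1 :=
  Matrix.nonsing_inv_mul _ (hg.isUnit_det hy)

theorem sum_metric_inv (hg : IsMetricOn g U) (hy : y ∈ U) (i j : Fin n) :
    ∑ k, g i k y * invMetric g k j y = if i = j then 1 else 0 := by
  have := congrFun (congrFun (hg.gMat_mul_invMat hy) i) j
  rwa [Matrix.mul_apply, Matrix.one_apply] at this

theorem smoothMat_gMat (hg : IsMetricOn g U) : SmoothMat (gMat g) U :=
  fun i j => hg.smooth i j

theorem smooth_det (hg : IsMetricOn g U) : ContDiffOn ℝ ∞ (fun y => (gMat g y).det) U := by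
  simp only [Matrix.det_apply]
  refine ContDiffOn.sum fun σ _ => ContDiffOn.const_smul _ ?_
  exact contDiffOn_prod fun i _ => hg.smooth _ _

/-- Cramer's rule: the adjugate and the determinant are polynomial in the smooth entries of `g`, and
the determinant has no zero on `U`. -/
theorem smoothMat_invMat (hg : IsMetricOn g U) : SmoothMat (invMat g) U := by
  intro i j
  have hadj : ContDiffOn ℝ ∞ (fun y => (gMat g y).adjugate i j) U := by
    simp only [Matrix.adjugate_apply, Matrix.det_apply]
    refine ContDiffOn.sum fun σ _ => ContDiffOn.const_smul _ (contDiffOn_prod fun k _ => ?_)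
    by_cases h : σ k = j
    · simp only [Matrix.updateRow_apply, h, if_true]; exact contDiffOn_const
    · simp only [Matrix.updateRow_apply, h, if_false]; exact hg.smooth _ _
  have := (hg.smooth_det.inv fun y hy => (hg.isUnit_det hy).ne_zero).mul hadj
  refine this.congr fun y hy => ?_
  simp [invMat, Matrix.inv_def, Ring.inverse_eq_inv']

theorem smooth_invMetric (hg : IsMetricOn g U) (i j : Fin n) :
    ContDiffOn ℝ ∞ (invMetric g i j) U :=
  hg.smoothMat_invMat i j

theorem smooth_tr (hg : IsMetricOn g U) {T : Comp2 n} (hT : ∀ i j, ContDiffOn ℝ ∞ (T i j) U) :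
    ContDiffOn ℝ ∞ (fun y => tr g y fun i j => T i j y) U :=
  ContDiffOn.sum fun i _ => ContDiffOn.sum fun j _ => (hg.smooth_invMetric i j).mul (hT i j)

theorem smooth_christoffel (hg : IsMetricOn g U) (k i j : Fin n) :
    ContDiffOn ℝ ∞ (christoffel g k i j) U := by
  refine contDiffOn_const.mul (ContDiffOn.sum fun l _ => (hg.smooth_invMetric k l).mul ?_)
  exact ((contDiffOn_pd i hg.isOpen (hg.smooth j l)).add
    (contDiffOn_pd j hg.isOpen (hg.smooth i l))).sub (contDiffOn_pd l hg.isOpen (hg.smooth i j))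

theorem smoothMat_chrMat (hg : IsMetricOn g U) (a : Fin n) : SmoothMat (chrMat g a) U :=
  fun i j => hg.smooth_christoffel i a j

theorem christoffel_symm (hg : IsMetricOn g U) (k i j : Fin n) (y : Coord n) :
    christoffel g k i j y = christoffel g k j i y := by
  have : g i j = g j i := funext fun y => hg.symm i j y
  simp only [christoffel, this]
  congr 1
  exact Finset.sum_congr rfl fun l _ => by ring

/-- Lowering cancels the inverse metric and leaves the Christoffel symbols of the first kind; two of
these add up to a derivative of `g`, which is metric compatibility. -/
theorem lower_christoffel (hg : IsMetricOn g U) (hy : y ∈ U) (c i j : Fin n) :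
    ∑ k, g c k y * christoffel g k i j y
      = (1 / 2) * (pd i (g j c) y + pd j (g i c) y - pd c (g i j) y) := by
  simp only [christoffel, Finset.mul_sum]
  rw [Finset.sum_comm]
  have : ∀ l, ∑ k, g c k y * (1 / 2 * (invMetric g k l y
      * (pd i (g j l) y + pd j (g i l) y - pd l (g i j) y)))
      = (if c = l then 1 else 0) * (1 / 2 * (pd i (g j l) y + pd j (g i l) y - pd l (g i j) y)) := by
    intro l
    rw [← hg.sum_metric_inv hy, Finset.sum_mul]
    exact Finset.sum_congr rfl fun k _ => by ring
  rw [Finset.sum_congr rfl fun l _ => this l]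
  simp

/-- The Levi-Civita connection is metric. -/
theorem pd_metric (hg : IsMetricOn g U) (hy : y ∈ U) (a b c : Fin n) :
    pd a (g b c) y = ∑ m, christoffel g m a b y * g m c y
      + ∑ m, christoffel g m a c y * g b m y := by
  have h1 := hg.lower_christoffel hy c a b
  have h2 := hg.lower_christoffel hy b a c
  have e1 : ∑ m, christoffel g m a b y * g m c y = ∑ k, g c k y * christoffel g k a b y :=
    Finset.sum_congr rfl fun m _ => by rw [hg.symm m c]; ring
  have e2 : ∑ m, christoffel g m a c y * g b m y = ∑ k, g b k y * christoffel g k a c y :=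
    Finset.sum_congr rfl fun m _ => by ring
  have e3 : g c b = g b c := funext fun y => hg.symm c b y
  rw [e1, e2, h1, h2, e3]
  ring

theorem pdM_gMat (hg : IsMetricOn g U) (hy : y ∈ U) (a : Fin n) :
    pdM a (gMat g) y = (chrMat g a y).transpose * gMat g y + gMat g y * chrMat g a y := by
  ext i j
  have := hg.pd_metric hy a i j
  simp only [Matrix.add_apply, Matrix.mul_apply]
  refine this.trans (congrArg₂ _ rfl (Finset.sum_congr rfl fun m _ => mul_comm _ _))

/-- Obtained by differentiating `g⁻¹ g = 1`; it expresses that the inverse metric is parallel. -/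
theorem pdM_invMat (hg : IsMetricOn g U) (hy : y ∈ U) (a : Fin n) :
    pdM a (invMat g) y
      = -(chrMat g a y * invMat g y) - invMat g y * (chrMat g a y).transpose := by
  have h1 : pdM a (fun z => invMat g z * gMat g z) y = 0 := by
    rw [pdM_congr a hg.isOpen hy (N := fun _ => 1) fun z hz => hg.invMat_mul_gMat hz, pdM_const]
  rw [pdM_mul a hg.isOpen hy hg.smoothMat_invMat hg.smoothMat_gMat, hg.pdM_gMat hy] at h1
  have h2 := congrArg (· * invMat g y) h1
  simp only [Matrix.add_mul, Matrix.mul_add, Matrix.zero_mul, Matrix.mul_assoc,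
    hg.gMat_mul_invMat hy, Matrix.mul_one] at h2
  rw [← Matrix.mul_assoc (invMat g y) (gMat g y), hg.invMat_mul_gMat hy, Matrix.one_mul] at h2
  rw [eq_neg_of_add_eq_zero_left h2]
  abel

theorem nabla2_metric (hg : IsMetricOn g U) (hy : y ∈ U) (a b c : Fin n) :
    nabla2 g g a b c y = 0 := by
  rw [nabla2, hg.pd_metric hy]; ring

theorem tr_swap (hg : IsMetricOn g U) (T : Fin n → Fin n → ℝ) :
    tr g y (fun i j => T j i) = tr g y fun i j => T i j := by
  simp only [tr]
  rw [Finset.sum_comm]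
  exact Finset.sum_congr rfl fun i _ => Finset.sum_congr rfl fun j _ => by
    rw [hg.invMetric_symm]

theorem tr_metric (hg : IsMetricOn g U) (hy : y ∈ U) : tr g y (fun i j => g i j y) = n := by
  have : ∀ i, ∑ j, invMetric g i j y * g i j y = 1 := fun i => by
    have := hg.sum_metric_inv hy i i
    rw [if_pos rfl] at this
    rw [← this]
    exact Finset.sum_congr rfl fun j _ => by rw [hg.invMetric_symm]; ring
  simp [tr, this]

theorem tr_metric_mul (hg : IsMetricOn g U) (hy : y ∈ U) (a : Fin n) (T : Fin n → ℝ) :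
    tr g y (fun i j => g a i y * T j) = T a := by
  simp only [tr]
  rw [Finset.sum_comm]
  have : ∀ j, ∑ i, invMetric g i j y * (g a i y * T j) = (if a = j then 1 else 0) * T j := by
    intro j
    rw [← hg.sum_metric_inv hy, Finset.sum_mul]
    exact Finset.sum_congr rfl fun k _ => by ring
  simp [this]

theorem tr_metric_mul' (hg : IsMetricOn g U) (hy : y ∈ U) (a : Fin n) (T : Fin n → ℝ) :
    tr g y (fun i j => g a j y * T i) = T a :=
  (hg.tr_swap (fun i j => g a i y * T j)).trans (hg.tr_metric_mul hy a T)

/-- Differentiating a metric contraction. -/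
theorem pd_tr (hg : IsMetricOn g U) (hy : y ∈ U) {T : Comp2 n}
    (hT : ∀ i j, ContDiffOn ℝ ∞ (T i j) U) (a : Fin n) :
    pd a (fun z => tr g z fun i j => T i j z) y = tr g y fun i j => nabla2 g T a i j y := by
  have hd : ∀ i j, DifferentiableAt ℝ (fun z => invMetric g i j z) y := fun i j =>
    differentiableAt_of_smooth hg.isOpen hy (hg.smooth_invMetric i j)
  have hTd : ∀ i j, DifferentiableAt ℝ (fun z => T i j z) y := fun i j =>
    differentiableAt_of_smooth hg.isOpen hy (hT i j)
  have hinv : ∀ i j, pd a (invMetric g i j) y = -(∑ m, christoffel g i a m y * invMetric g m j y)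
      - ∑ m, invMetric g i m y * christoffel g j a m y := fun i j =>
    congrFun (congrFun (hg.pdM_invMat hy a) i) j
  have h1 : pd a (fun z => tr g z fun i j => T i j z) y
      = ∑ i, ∑ j, (pd a (invMetric g i j) y * T i j y + invMetric g i j y * pd a (T i j) y) := by
    simp only [tr]
    rw [pd_sum _ _ fun i _ => DifferentiableAt.fun_sum fun j _ => (hd i j).fun_mul (hTd i j)]
    refine Finset.sum_congr rfl fun i _ => ?_
    rw [pd_sum _ _ fun j _ => (hd i j).fun_mul (hTd i j)]
    exact Finset.sum_congr rfl fun j _ => pd_mul a (hd i j) (hTd i j)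
  rw [h1]
  simp only [tr, nabla2, hinv, mul_sub, sub_mul, neg_mul, Finset.sum_add_distrib,
    Finset.sum_sub_distrib, Finset.sum_neg_distrib, Finset.mul_sum, Finset.sum_mul]
  -- Only summation indices are renamed: the Christoffel terms of `∂g⁻¹` become those of `∇T`.
  have e1 : ∑ i, ∑ j, ∑ m, christoffel g i a m y * invMetric g m j y * T i j y
      = ∑ i, ∑ j, ∑ m, invMetric g i j y * (christoffel g m a i y * T m j y) := by
    refine Finset.sum_comm.trans (Eq.trans ?_ Finset.sum_comm)
    refine Finset.sum_congr rfl fun j _ => Finset.sum_comm.trans ?_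
    exact Finset.sum_congr rfl fun i _ => Finset.sum_congr rfl fun m _ => by ring
  have e2 : ∑ i, ∑ j, ∑ m, invMetric g i m y * christoffel g j a m y * T i j y
      = ∑ i, ∑ j, ∑ m, invMetric g i j y * (christoffel g m a j y * T i m y) := by
    refine Finset.sum_congr rfl fun i _ => ?_
    rw [Finset.sum_comm]
    exact Finset.sum_congr rfl fun j _ => Finset.sum_congr rfl fun m _ => by ring
  rw [e1, e2]
  ring

end IsMetricOn
end ConformalCodazzi

/-! ### Symmetries and contractions of the Riemann and Weyl tensors -/

namespace ConformalCodazzi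

variable {n : ℕ} {U : Set (Coord n)} {y : Coord n} {g : Comp2 n}

theorem riemann_eq_curvMat (g : Comp2 n) (a b c d : Fin n) (y : Coord n) :
    riemann g a b c d y = curvMat (chrMat g) a b y c d := by
  simp only [riemann, curvMat, Matrix.add_apply, Matrix.sub_apply, Matrix.mul_apply,
    Finset.sum_sub_distrib]
  rfl

theorem riemannLow_eq_mul (g : Comp2 n) (a b c d : Fin n) (y : Coord n) :
    riemannLow g a b c d y = (gMat g y * curvMat (chrMat g) a b y) c d := by
  simp only [riemannLow, riemann_eq_curvMat, Matrix.mul_apply]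
  rfl

theorem riemann_skew (g : Comp2 n) (a b c d : Fin n) (y : Coord n) :
    riemann g a b c d y = -riemann g b a c d y := by
  rw [riemann_eq_curvMat, riemann_eq_curvMat, curvMat_skew]; rfl

theorem riemannLow_skew (g : Comp2 n) (a b c d : Fin n) (y : Coord n) :
    riemannLow g a b c d y = -riemannLow g b a c d y := by
  simp only [riemannLow, riemann_skew g a b, mul_neg, Finset.sum_neg_distrib]

namespace IsMetricOn

theorem riemann_bianchi (hg : IsMetricOn g U) (a b c d : Fin n) (y : Coord n) :
    riemann g a b c d y + riemann g b d c a y + riemann g d a c b y = 0 := by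
  have hs : ∀ k i j, christoffel g k i j = christoffel g k j i := fun k i j =>
    funext fun y => hg.christoffel_symm k i j y
  simp only [riemann, Finset.sum_sub_distrib, hs _ d b, hs _ d a, hs _ b a]
  ring

/-- The mixed second derivatives of `g` agree; inserting `∂g = Γᵀ g + g Γ` twice turns this into
skewness of the lowered curvature. -/
theorem gMat_mul_curv (hg : IsMetricOn g U) (hy : y ∈ U) (a b : Fin n) :
    gMat g y * curvMat (chrMat g) a b y + (curvMat (chrMat g) a b y).transpose * gMat g y = 0 := by
  have hU := hg.isOpen
  have hΓ := hg.smoothMat_chrMat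
  have hG := hg.smoothMat_gMat
  have hΓt : ∀ c, SmoothMat (fun z => (chrMat g c z).transpose) U := fun c i j => hΓ c j i
  have key : ∀ p q : Fin n, pdM p (pdM q (gMat g)) y
      = (pdM p (chrMat g q) y).transpose * gMat g y
        + (chrMat g q y).transpose * ((chrMat g p y).transpose * gMat g y
            + gMat g y * chrMat g p y)
        + (((chrMat g p y).transpose * gMat g y + gMat g y * chrMat g p y) * chrMat g q y
        + gMat g y * pdM p (chrMat g q) y) := by
    intro p q
    rw [pdM_congr p hU hy fun z hz => hg.pdM_gMat hz q,
      pdM_add p hU hy ((hΓt q).mul hG) (hG.mul (hΓ q)), pdM_mul p hU hy (hΓt q) hG,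
      pdM_mul p hU hy hG (hΓ q), hg.pdM_gMat hy]
    rfl
  have h := pdM_comm a b hU hy hG
  rw [key, key] at h
  rw [← sub_eq_zero] at h
  rw [← h]
  simp only [curvMat, Matrix.transpose_add, Matrix.transpose_sub, Matrix.transpose_mul]
  noncomm_ring

theorem riemannLow_skew_right (hg : IsMetricOn g U) (hy : y ∈ U) (a b c d : Fin n) :
    riemannLow g a b c d y = -riemannLow g a b d c y := by
  have h := congrFun (congrFun (hg.gMat_mul_curv hy a b) c) d
  have h2 : (curvMat (chrMat g) a b y).transpose * gMat g y
      = (gMat g y * curvMat (chrMat g) a b y).transpose := by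
    rw [Matrix.transpose_mul, hg.gMat_transpose]
  rw [h2, Matrix.add_apply, Matrix.transpose_apply, Matrix.zero_apply, ← riemannLow_eq_mul,
    ← riemannLow_eq_mul] at h
  linarith

/-- By `gMat_mul_curv` the curvature matrix is minus a conjugate of its transpose, so it has trace
zero. This makes the contracted first Bianchi identity yield symmetry of the Ricci tensor. -/
theorem sum_riemann_self (hg : IsMetricOn g U) (hy : y ∈ U) (a b : Fin n) :
    ∑ c, riemann g a b c c y = 0 := by
  have h := congrArg (invMat g y * ·) (hg.gMat_mul_curv hy a b)
  simp only [Matrix.mul_add, ← Matrix.mul_assoc, hg.invMat_mul_gMat hy, Matrix.one_mul,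
    Matrix.mul_zero] at h
  have h2 := congrArg Matrix.trace h
  rw [Matrix.trace_add, Matrix.mul_assoc, Matrix.trace_mul_comm, Matrix.mul_assoc,
    hg.gMat_mul_invMat hy, Matrix.mul_one, Matrix.trace_transpose, Matrix.trace_zero] at h2
  have h3 : ∑ c, riemann g a b c c y = (curvMat (chrMat g) a b y).trace := by
    simp only [riemann_eq_curvMat]; rfl
  rw [h3]; linarith

theorem ricci_symm (hg : IsMetricOn g U) (hy : y ∈ U) (b d : Fin n) :
    ricci g b d y = ricci g d b y := by
  have h : ∑ a, (riemann g a b a d y + riemann g b d a a y + riemann g d a a b y) = 0 :=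
    Finset.sum_eq_zero fun a _ => hg.riemann_bianchi a b a d y
  simp only [riemann_skew g d _ _ b, Finset.sum_add_distrib, Finset.sum_neg_distrib,
    hg.sum_riemann_self hy] at h
  simp only [ricci]
  linarith

theorem schouten_symm (hg : IsMetricOn g U) (hy : y ∈ U) (b d : Fin n) :
    schouten g b d y = schouten g d b y := by
  simp only [schouten, hg.ricci_symm hy b d, hg.symm b d y]

theorem ricciOf_riemannLow (hg : IsMetricOn g U) (hy : y ∈ U) (b d : Fin n) :
    ricciOf g (riemannLow g) b d y = ricci g b d y := by
  have h : ∀ a m, ∑ c, invMetric g a c y * (g c m y * riemann g a b m d y)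
      = (if m = a then 1 else 0) * riemann g a b m d y := fun a m => by
    rw [← hg.sum_metric_inv hy, Finset.sum_mul]
    refine Finset.sum_congr rfl fun c _ => ?_
    rw [hg.invMetric_symm, hg.symm]; ring
  simp only [ricciOf, tr, riemannLow, ricci, Finset.mul_sum]
  refine Finset.sum_congr rfl fun a _ => ?_
  rw [Finset.sum_comm, Finset.sum_congr rfl fun m _ => h a m]
  simp

end IsMetricOn

theorem kn_eq (g Q : Comp2 n) (a b c d : Fin n) (y : Coord n) :
    kn g Q a b c d y = g c a y * Q b d y - g c b y * Q a d y - g d a y * Q b c y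
      + g d b y * Q a c y := by
  simp only [kn, skew]; ring

namespace IsMetricOn

/-- The coefficient `n - 2` is what separates dimension two, where the contraction retains only the
trace of `Q`. -/
theorem ricciOf_kn (hg : IsMetricOn g U) (hy : y ∈ U) (Q : Comp2 n) (b d : Fin n) :
    ricciOf g (kn g Q) b d y
      = ((n : ℝ) - 2) * Q b d y + g b d y * tr g y fun i j => Q i j y := by
  have h1 : tr g y (fun a c => g c a y * Q b d y) = n * Q b d y := by
    rw [tr_mul_right, hg.tr_swap (fun a c => g a c y), hg.tr_metric hy]
  have h2 : tr g y (fun a c => g c b y * Q a d y) = Q b d y := by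
    simp only [fun c => hg.symm c b y]
    exact hg.tr_metric_mul' hy b fun a => Q a d y
  have h3 := hg.tr_metric_mul hy d fun c => Q b c y
  have h4 := tr_mul_left (g := g) (y := y) (g d b y) (fun a c => Q a c y)
  simp only [ricciOf, kn_eq]
  rw [tr_add, tr_sub, tr_sub, h1, h2, h3, h4, hg.symm b d y]
  ring

theorem tr_schouten (hg : IsMetricOn g U) (hy : y ∈ U) (hn : 3 ≤ n) :
    tr g y (fun i j => schouten g i j y) = scal g y / (2 * ((n : ℝ) - 1)) := by
  have h3 : (3 : ℝ) ≤ n := by exact_mod_cast hn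
  have h1 : (n : ℝ) - 2 ≠ 0 := by intro h; linarith
  have h2 : (n : ℝ) - 1 ≠ 0 := by intro h; linarith
  simp only [schouten]
  rw [tr_mul_left, tr_sub, tr_mul_left, hg.tr_metric hy]
  change 1 / ((n : ℝ) - 2) * (scal g y - _) = _
  field_simp
  ring

/-- The Schouten tensor is the solution `Q` of `ricciOf (kn Q) = Ric`. -/
theorem ricciOf_weyl (hg : IsMetricOn g U) (hy : y ∈ U) (hn : 3 ≤ n) (b d : Fin n) :
    ricciOf g (weyl g (schouten g)) b d y = 0 := by
  have h3 : (3 : ℝ) ≤ n := by exact_mod_cast hn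
  have h1 : (n : ℝ) - 2 ≠ 0 := by intro h; linarith
  have h2 : (n : ℝ) - 1 ≠ 0 := by intro h; linarith
  have e1 := hg.ricciOf_riemannLow hy b d
  have e2 := hg.ricciOf_kn hy (schouten g) b d
  rw [hg.tr_schouten hy hn] at e2
  simp only [ricciOf] at e1 e2
  simp only [ricciOf, weyl]
  rw [tr_sub, e1, e2, schouten]
  field_simp
  ring

end IsMetricOn

/-! ### Tensors determined by their traces in dimensions two and three -/

section LowDimensions

/-- In dimension two a tensor `X_{abc}` skew in `a, b` is determined by its contraction over
`b, c`. -/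
theorem IsMetricOn.eq_zero_of_tr_of_two (hg : IsMetricOn g U) (hy : y ∈ U) (hn : n = 2)
    (X : Fin n → Fin n → Fin n → ℝ) (hX : ∀ a b c, X a b c = -X b a c)
    (h : ∀ a, tr g y (fun b c => X a b c) = 0) (a b c : Fin n) : X a b c = 0 := by
  subst hn
  have hd : ∀ a c, X a a c = 0 := fun a c => by linarith [hX a a c]
  have key : ∀ c, X 0 1 c = 0 := by
    -- Skewness leaves the single vector `X 0 1`, and the contractions for `a = 0, 1` are, up to
    -- sign, the two entries of `g⁻¹` applied to it.
    have hv : (invMat g y).mulVec (X 0 1) = 0 := by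
      have h0 := h 0
      have h1 := h 1
      simp only [tr, Fin.sum_univ_two, hd, hX 1 0] at h0 h1
      ext i
      simp only [Matrix.mulVec, dotProduct, Fin.sum_univ_two, ← invMetric_eq, Pi.zero_apply]
      fin_cases i
      · simp only [Fin.zero_eta]; linarith
      · simp only [Fin.mk_one]; linarith
    have h2 : (gMat g y).mulVec ((invMat g y).mulVec (X 0 1)) = X 0 1 := by
      rw [Matrix.mulVec_mulVec, hg.gMat_mul_invMat hy, Matrix.one_mulVec]
    rw [hv, Matrix.mulVec_zero] at h2
    intro c
    rw [← h2]; rfl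
  fin_cases a <;> fin_cases b
  · exact hd 0 c
  · exact key c
  · have h3 := hX 1 0 c
    rw [key c, neg_zero] at h3
    exact h3
  · exact hd 1 c

/-- In dimension two a tensor skew in both pairs of indices is determined by its double trace. -/
theorem IsMetricOn.eq_zero_of_tr_tr_of_two (hg : IsMetricOn g U) (hy : y ∈ U) (hn : n = 2)
    (X : Fin n → Fin n → Fin n → Fin n → ℝ) (hX : ∀ a b c d, X a b c d = -X b a c d)
    (hX' : ∀ a b c d, X a b c d = -X a b d c)
    (h : tr g y (fun b d => tr g y fun a c => X a b c d) = 0) (a b c d : Fin n) :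
    X a b c d = 0 := by
  subst hn
  have hd : ∀ a c d, X a a c d = 0 := fun a c d => by linarith [hX a a c d]
  have hd' : ∀ a b c, X a b c c = 0 := fun a b c => by linarith [hX' a b c c]
  have hdet : invMetric g 0 0 y * invMetric g 1 1 y - invMetric g 0 1 y * invMetric g 1 0 y ≠ 0 := by
    have := congrArg Matrix.det (hg.gMat_mul_invMat hy)
    rw [Matrix.det_mul, Matrix.det_one] at this
    have h2 : (invMat g y).det ≠ 0 := right_ne_zero_of_mul_eq_one this
    rwa [Matrix.det_fin_two] at h2
  have key : X 0 1 0 1 = 0 := by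
    simp only [tr, Fin.sum_univ_two, hd, hd', hX 1 0, hX' 0 1 1 0] at h
    -- The double trace is `2 det(g⁻¹) X₀₁₀₁`.
    have h4 : X 0 1 0 1 * (invMetric g 0 0 y * invMetric g 1 1 y
        - invMetric g 0 1 y * invMetric g 1 0 y) = 0 := by
      have := hg.invMetric_symm 0 1 y
      linear_combination h / 2
    exact (mul_eq_zero.1 h4).resolve_right hdet
  have k2 : X 0 1 1 0 = 0 := by rw [hX', key, neg_zero]
  have k3 : X 1 0 0 1 = 0 := by rw [hX, key, neg_zero]
  have k4 : X 1 0 1 0 = 0 := by rw [hX, k2, neg_zero]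
  fin_cases a <;> fin_cases b <;> fin_cases c <;> fin_cases d <;>
    first | exact hd _ _ _ | exact hd' _ _ _ | assumption

/-- In dimension three a tensor skew in both pairs of indices is determined by its Ricci
contraction. -/
theorem IsMetricOn.eq_zero_of_tr_of_three (hg : IsMetricOn g U) (hy : y ∈ U) (hn : n = 3)
    (X : Fin n → Fin n → Fin n → Fin n → ℝ) (hX : ∀ a b c d, X a b c d = -X b a c d)
    (hX' : ∀ a b c d, X a b c d = -X a b d c)
    (h : ∀ b d, tr g y (fun a c => X a b c d) = 0) (a b c d : Fin n) :
    X a b c d = 0 := by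
  subst hn
  have hd : ∀ a c d, X a a c d = 0 := fun a c d => by linarith [hX a a c d]
  have hd' : ∀ a b c, X a b c c = 0 := fun a b c => by linarith [hX' a b c c]
  have hdet : (invMat g y).det ≠ 0 := by
    have := congrArg Matrix.det (hg.gMat_mul_invMat hy)
    rw [Matrix.det_mul, Matrix.det_one] at this
    exact right_ne_zero_of_mul_eq_one this
  rw [Matrix.det_fin_three] at hdet
  have hH : invMetric g 1 0 y = invMetric g 0 1 y ∧ invMetric g 2 0 y = invMetric g 0 2 y
      ∧ invMetric g 2 1 y = invMetric g 1 2 y :=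
    ⟨hg.invMetric_symm 1 0 y, hg.invMetric_symm 2 0 y, hg.invMetric_symm 2 1 y⟩
  simp only [← invMetric_eq, hH] at hdet
  -- Up to sign this is the Einstein tensor of `X` with raised indices. In dimension three its `i j`
  -- entry is `± det(g⁻¹)` times the component of `X` whose second pair omits `i` and whose first
  -- pair omits `j`, so each of the nine independent components is read off from one entry. No pair
  -- symmetry of `X` is needed.
  have S : ∀ i j, ∑ b, ∑ d, (invMetric g b d y * invMetric g i j y / 2
      - invMetric g i b y * invMetric g d j y) * tr g y (fun a c => X a b c d) = 0 :=
    fun i j => Finset.sum_eq_zero fun b _ => Finset.sum_eq_zero fun d _ => by rw [h, mul_zero]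
  simp only [tr, Fin.sum_univ_three, hd, hd', hX 1 0, hX 2 0, hX 2 1, hX' _ _ 1 0, hX' _ _ 2 0,
    hX' _ _ 2 1, hH] at S
  have k0101 : X 0 1 0 1 = 0 := by
    have := S 2 2
    try simp only [hH] at this
    exact (mul_eq_zero.1 (by linear_combination this)).resolve_left hdet
  have k0102 : X 0 1 0 2 = 0 := by
    have := S 1 2
    try simp only [hH] at this
    exact (mul_eq_zero.1 (by linear_combination -this)).resolve_left hdet
  have k0112 : X 0 1 1 2 = 0 := by
    have := S 0 2
    try simp only [hH] at this
    exact (mul_eq_zero.1 (by linear_combination this)).resolve_left hdet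
  have k0201 : X 0 2 0 1 = 0 := by
    have := S 2 1
    try simp only [hH] at this
    exact (mul_eq_zero.1 (by linear_combination -this)).resolve_left hdet
  have k0202 : X 0 2 0 2 = 0 := by
    have := S 1 1
    try simp only [hH] at this
    exact (mul_eq_zero.1 (by linear_combination this)).resolve_left hdet
  have k0212 : X 0 2 1 2 = 0 := by
    have := S 0 1
    try simp only [hH] at this
    exact (mul_eq_zero.1 (by linear_combination -this)).resolve_left hdet
  have k1201 : X 1 2 0 1 = 0 := by
    have := S 2 0
    try simp only [hH] at this
    exact (mul_eq_zero.1 (by linear_combination this)).resolve_left hdet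
  have k1202 : X 1 2 0 2 = 0 := by
    have := S 1 0
    try simp only [hH] at this
    exact (mul_eq_zero.1 (by linear_combination -this)).resolve_left hdet
  have k1212 : X 1 2 1 2 = 0 := by
    have := S 0 0
    try simp only [hH] at this
    exact (mul_eq_zero.1 (by linear_combination this)).resolve_left hdet
  have key : ∀ a b, X a b 0 1 = 0 ∧ X a b 0 2 = 0 ∧ X a b 1 2 = 0 := by
    intro a b
    fin_cases a <;> fin_cases b <;>
      simp [hd, hX 1 0, hX 2 0, hX 2 1, k0101, k0102, k0112, k0201, k0202, k0212, k1201, k1202,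
        k1212]
  obtain ⟨e1, e2, e3⟩ := key a b
  fin_cases c <;> fin_cases d <;> simp [hd', hX' _ _ 1 0, hX' _ _ 2 0, hX' _ _ 2 1, e1, e2, e3]

end LowDimensions
end ConformalCodazzi

/-! ### The modified tractor connection as a matrix connection -/

namespace ConformalCodazzi

variable {n : ℕ} {U : Set (Coord n)} {y : Coord n} {g : Comp2 n}

/-- The index set of the tractor components `(σ, μ^b, φ)`. -/
abbrev TIdx (n : ℕ) := Unit ⊕ (Fin n ⊕ Unit)

/-- Raising the index of a one-form. -/
noncomputable def raise (g : Comp2 n) (T : Comp1 n) : Comp1 n := fun c y =>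
  ∑ d, invMetric g c d y * T d y

/-- The connection matrices of `∇ - Ã`, where `Q = P - E` and `S = P + G`. -/
noncomputable def connMat (g Q S : Comp2 n) (F : Comp1 n) (A : Comp3 n) (a : Fin n)
    (y : Coord n) : Matrix (TIdx n) (TIdx n) ℝ := Matrix.of fun i j =>
  match i, j with
  | .inl _, .inl _ => 0
  | .inl _, .inr (.inl c) => -g a c y
  | .inl _, .inr (.inr _) => 0
  | .inr (.inl b), .inl _ => raise g (Q a) b y
  | .inr (.inl b), .inr (.inl c) => christoffel g b a c y - raise g (A a c) b y
  | .inr (.inl b), .inr (.inr _) => if a = b then 1 else 0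
  | .inr (.inr _), .inl _ => -F a y
  | .inr (.inr _), .inr (.inl c) => -S a c y
  | .inr (.inr _), .inr (.inr _) => 0

/-- The components of a tractor field as a column. -/
def toCol (s : Tractor n) (y : Coord n) : Matrix (TIdx n) Unit ℝ := Matrix.of fun i _ =>
  match i with
  | .inl _ => s.σ y
  | .inr (.inl b) => s.μ b y
  | .inr (.inr _) => s.φ y

/-- The tractor field with constant components. -/
def constTractor (v : TIdx n → ℝ) : Tractor n where
  σ _ := v (.inl ())
  μ b _ := v (.inr (.inl b))
  φ _ := v (.inr (.inr ()))

theorem toCol_constTractor (v : TIdx n → ℝ) (y : Coord n) :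
    toCol (constTractor v) y = Matrix.of fun i _ => v i := by
  ext i j
  rcases i with _ | _ | _ <;> rfl

theorem smoothOn_constTractor (v : TIdx n → ℝ) (U : Set (Coord n)) :
    (constTractor v).SmoothOn U :=
  ⟨contDiffOn_const, fun _ => contDiffOn_const, contDiffOn_const⟩

theorem smoothMat_toCol {s : Tractor n} (hs : s.SmoothOn U) : SmoothMat (toCol s) U := by
  intro i j
  rcases i with _ | i | _
  · exact hs.1
  · exact hs.2.1 i
  · exact hs.2.2

/-- `P` enters the `μ` slot with a plus sign and the `φ` slot with a minus sign, so subtracting `Ã`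
produces `P - E` in the first and `-(P + G)` in the second. -/
theorem toCol_modNabla (g P E G : Comp2 n) (F : Comp1 n) (A : Comp3 n) (a : Fin n)
    (s : Tractor n) (y : Coord n) :
    toCol (modNabla g P E G F A a s) y = pdM a (toCol s) y
      + connMat g (fun a b y => P a b y - E a b y) (fun a b y => P a b y + G a b y) F A a y
        * toCol s y := by
  ext i j
  rcases i with _ | i | _
  · simp [toCol, modNabla, tractorNabla, tractorA, pdM, connMat, Matrix.mul_apply, sub_eq_add_neg]
  · simp only [toCol, modNabla, tractorNabla, tractorA, nablaVec, raise, pdM, connMat,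
      Matrix.of_apply, Matrix.add_apply, Matrix.mul_apply, Fintype.sum_sum_type,
      Finset.univ_unique, Finset.sum_singleton, sub_mul, mul_sub, Finset.sum_sub_distrib, ite_mul,
      one_mul, zero_mul]
    ring
  · simp only [toCol, modNabla, tractorNabla, tractorA, raise, pdM, connMat,
      Matrix.of_apply, Matrix.add_apply, Matrix.mul_apply, Fintype.sum_sum_type,
      Finset.univ_unique, Finset.sum_singleton, neg_mul, add_mul, Finset.sum_add_distrib,
      Finset.sum_neg_distrib, neg_add, zero_mul]
    ring

theorem toCol_eq_iff (s t : Tractor n) (y : Coord n) :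
    toCol s y = toCol t y ↔ s.σ y = t.σ y ∧ (∀ c, s.μ c y = t.μ c y) ∧ s.φ y = t.φ y := by
  constructor
  · intro h
    have h' := fun i => congrFun (congrFun h i) ()
    exact ⟨h' (.inl ()), fun c => h' (.inr (.inl c)), h' (.inr (.inr ()))⟩
  · rintro ⟨h1, h2, h3⟩
    ext i j
    rcases i with _ | i | _
    exacts [h1, h2 i, h3]

/-- The commutator of covariant derivatives is multiplication by the curvature matrix, and constant
basis tractors already detect each of its columns. -/
theorem flatOn_iff_curvMat {P E G : Comp2 n} {F : Comp1 n} {A : Comp3 n} (hU : IsOpen U)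
    (hM : ∀ a, SmoothMat (connMat g (fun a b y => P a b y - E a b y)
      (fun a b y => P a b y + G a b y) F A a) U) :
    FlatOn g P E G F A U ↔ ∀ y ∈ U, ∀ a b, curvMat (connMat g (fun a b y => P a b y - E a b y)
      (fun a b y => P a b y + G a b y) F A) a b y = 0 := by
  set M := connMat g (fun a b y => P a b y - E a b y) (fun a b y => P a b y + G a b y) F A
  have key : ∀ s : Tractor n, s.SmoothOn U → ∀ a b, ∀ y ∈ U,
      toCol (modNabla g P E G F A a (modNabla g P E G F A b s)) y
        - toCol (modNabla g P E G F A b (modNabla g P E G F A a s)) y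
        = curvMat M a b y * toCol s y := by
    intro s hs a b y hy
    rw [← commutator_eq_curvMat hU hy hM (smoothMat_toCol hs)]
    simp only [toCol_modNabla _ _ _ _ _ _ _ (modNabla _ _ _ _ _ _ _ _)]
    rw [pdM_congr a hU hy fun z _ => toCol_modNabla g P E G F A b s z,
      pdM_congr b hU hy fun z _ => toCol_modNabla g P E G F A a s z,
      toCol_modNabla g P E G F A b s y, toCol_modNabla g P E G F A a s y]
  constructor
  · intro h y hy a b
    ext i j
    have h1 := key (constTractor (Pi.single j 1)) (smoothOn_constTractor _ _) a b y hy
    rw [(toCol_eq_iff _ _ y).2 (h _ (smoothOn_constTractor _ _) a b y hy), sub_self,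
      toCol_constTractor] at h1
    have h2 := congrFun (congrFun h1 i) ()
    simpa [Matrix.mul_apply, Pi.single_apply] using h2.symm
  · intro h s hs a b y hy
    refine (toCol_eq_iff _ _ y).1 (sub_eq_zero.1 ?_)
    rw [key s hs a b y hy, h y hy, Matrix.zero_mul]

section Raise

theorem IsMetricOn.smooth_raise (hg : IsMetricOn g U) {T : Comp1 n}
    (hT : ∀ d, ContDiffOn ℝ ∞ (T d) U) (c : Fin n) : ContDiffOn ℝ ∞ (raise g T c) U :=
  ContDiffOn.sum fun d _ => (hg.smooth_invMetric c d).mul (hT d)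

theorem IsMetricOn.sum_metric_raise (hg : IsMetricOn g U) (hy : y ∈ U) (T : Comp1 n)
    (e : Fin n) : ∑ c, g e c y * raise g T c y = T e y := by
  rw [← hg.tr_metric_mul hy e fun j => T j y]
  simp only [tr, raise, Finset.mul_sum]
  exact Finset.sum_congr rfl fun i _ => Finset.sum_congr rfl fun j _ => by ring

theorem sum_mul_raise (T : Fin n → ℝ) (T' : Comp1 n) :
    ∑ m, T m * raise g T' m y = tr g y fun m j => T m * T' j y := by
  simp only [tr, raise, Finset.mul_sum]
  exact Finset.sum_congr rfl fun i _ => Finset.sum_congr rfl fun j _ => by ring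

/-- Raising and lowering indices commutes with the Levi-Civita connection. -/
theorem IsMetricOn.sum_metric_nablaVec_raise (hg : IsMetricOn g U) (hy : y ∈ U) {T : Comp1 n}
    (hT : ∀ d, ContDiffOn ℝ ∞ (T d) U) (a e : Fin n) :
    ∑ c, g e c y * nablaVec g (raise g T) a c y = nabla1 g T a e y := by
  have hd : ∀ c, DifferentiableAt ℝ (fun z => raise g T c z) y := fun c =>
    differentiableAt_of_smooth hg.isOpen hy (hg.smooth_raise hT c)
  have hgd : ∀ c, DifferentiableAt ℝ (fun z => g e c z) y := fun c =>
    differentiableAt_of_smooth hg.isOpen hy (hg.smooth e c)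
  -- `T` is written as the lowering of its raised form, so that the product rule produces `∂g`, to
  -- which metric compatibility applies.
  have h1 : pd a (T e) y = ∑ c, (pd a (g e c) y * raise g T c y
      + g e c y * pd a (raise g T c) y) := by
    rw [pd_congr a hg.isOpen hy fun z hz => (hg.sum_metric_raise hz T e).symm,
      pd_sum _ _ fun c _ => (hgd c).fun_mul (hd c)]
    exact Finset.sum_congr rfl fun c _ => pd_mul a (hgd c) (hd c)
  have h2 : ∑ m, christoffel g m a e y * T m y
      = ∑ c, ∑ m, christoffel g m a e y * g m c y * raise g T c y := by
    rw [Finset.sum_comm]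
    refine Finset.sum_congr rfl fun m _ => ?_
    rw [← hg.sum_metric_raise hy T m, Finset.mul_sum]
    exact Finset.sum_congr rfl fun c _ => by ring
  have h3 : ∑ c, ∑ m, christoffel g m a c y * g e m y * raise g T c y
      = ∑ c, g e c y * ∑ m, christoffel g c a m y * raise g T m y := by
    rw [Finset.sum_comm]
    refine Finset.sum_congr rfl fun c _ => ?_
    rw [Finset.mul_sum]
    exact Finset.sum_congr rfl fun m _ => by ring
  simp only [nabla1, nablaVec, h1, h2, hg.pd_metric hy a e, mul_add, add_mul,
    Finset.sum_add_distrib, Finset.sum_mul, ← h3]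
  ring

end Raise
end ConformalCodazzi

/-! ### Components of the tractor curvature -/

namespace ConformalCodazzi

variable {n : ℕ} {U : Set (Coord n)} {y : Coord n} {g Q S : Comp2 n} {F : Comp1 n} {A : Comp3 n}

/-- Smooth data `Q, S, F, A` on a coordinate patch with metric `g`, with `Q`, `S` symmetric and `A`
totally symmetric. -/
structure IsConnOn (g Q S : Comp2 n) (F : Comp1 n) (A : Comp3 n) (U : Set (Coord n)) : Prop where
  metric : IsMetricOn g U
  smoothQ : ∀ a b, ContDiffOn ℝ ∞ (Q a b) U
  smoothS : ∀ a b, ContDiffOn ℝ ∞ (S a b) U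
  smoothF : ∀ a, ContDiffOn ℝ ∞ (F a) U
  smoothA : ∀ a b c, ContDiffOn ℝ ∞ (A a b c) U
  symmQ : ∀ y ∈ U, ∀ a b, Q a b y = Q b a y
  symmS : ∀ y ∈ U, ∀ a b, S a b y = S b a y
  symmA : ∀ a b c y, A a b c y = A b a c y
  symmA' : ∀ a b c y, A a b c y = A a c b y

/-- The component `σ → μ_e` of the curvature. -/
noncomputable def curvVec (g Q : Comp2 n) (F : Comp1 n) (A : Comp3 n) (a b e : Fin n)
    (y : Coord n) : ℝ :=
  nabla2 g Q a b e y - nabla2 g Q b a e y - (g e a y * F b y - g e b y * F a y)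
    - (tr g y (fun m j => A a m e y * Q b j y) - tr g y fun m j => A b m e y * Q a j y)

/-- The component `μ^d → μ_e` of the curvature. -/
noncomputable def curvEnd (g Q S : Comp2 n) (A : Comp3 n) (a b e d : Fin n) (y : Coord n) : ℝ :=
  riemannLow g a b e d y - (g e a y * S b d y - g e b y * S a d y)
    - (Q a e y * g b d y - Q b e y * g a d y)
    - (nabla3 g A a b d e y - nabla3 g A b a d e y)
    + (tr g y (fun m j => A a m e y * A b d j y) - tr g y fun m j => A b m e y * A a d j y)

/-- The component `μ^d → φ` of the curvature. -/
noncomputable def curvForm (g S : Comp2 n) (F : Comp1 n) (A : Comp3 n) (a b d : Fin n)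
    (y : Coord n) : ℝ :=
  F a y * g b d y - F b y * g a d y - (nabla2 g S a b d y - nabla2 g S b a d y)
    + (tr g y (fun m j => S a m y * A b d j y) - tr g y fun m j => S b m y * A a d j y)

/-- The component `σ → φ` of the curvature. -/
noncomputable def curvScal (g Q S : Comp2 n) (F : Comp1 n) (a b : Fin n) (y : Coord n) : ℝ :=
  -(nabla1 g F a b y - nabla1 g F b a y)
    - (tr g y (fun m j => S a m y * Q b j y) - tr g y fun m j => S b m y * Q a j y)

namespace IsConnOn

theorem smoothMat_connMat (h : IsConnOn g Q S F A U) (a : Fin n) :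
    SmoothMat (connMat g Q S F A a) U := by
  intro i j
  rcases i with _ | i | _ <;> rcases j with _ | j | _
  · exact contDiffOn_const
  · exact (h.metric.smooth a j).neg
  · exact contDiffOn_const
  · exact h.metric.smooth_raise (h.smoothQ a) i
  · exact (h.metric.smooth_christoffel i a j).sub (h.metric.smooth_raise (h.smoothA a j) i)
  · exact contDiffOn_const
  · exact (h.smoothF a).neg
  · exact (h.smoothS a j).neg
  · exact contDiffOn_const

theorem curvMat_entry (M : Fin n → Coord n → Matrix (TIdx n) (TIdx n) ℝ) (a b : Fin n)
    (i j : TIdx n) : curvMat M a b y i j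
      = pd a (fun z => M b z i j) y - pd b (fun z => M a z i j) y
        + ((M a y i (.inl ()) * M b y (.inl ()) j
            + (∑ c, M a y i (.inr (.inl c)) * M b y (.inr (.inl c)) j
            + M a y i (.inr (.inr ())) * M b y (.inr (.inr ())) j))
          - (M b y i (.inl ()) * M a y (.inl ()) j
            + (∑ c, M b y i (.inr (.inl c)) * M a y (.inr (.inl c)) j
            + M b y i (.inr (.inr ())) * M a y (.inr (.inr ())) j))) := by
  simp [curvMat, Matrix.mul_apply, Fintype.sum_sum_type, pdM]

/-- This and the next four lemmas dispose of the entries that vanish by symmetry alone: `σ → σ` by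
symmetry of `Q`, `μ → σ` by metric compatibility, zero torsion and symmetry of `A`, `φ → σ` by
symmetry of `g`, `φ → μ` by zero torsion and symmetry of `A`, and `φ → φ` by symmetry of `S`. -/
theorem curv_σσ (h : IsConnOn g Q S F A U) (hy : y ∈ U) (a b : Fin n) :
    curvMat (connMat g Q S F A) a b y (.inl ()) (.inl ()) = 0 := by
  rw [curvMat_entry]
  simp only [connMat, Matrix.of_apply, pd_const, neg_mul, Finset.sum_neg_distrib,
    h.metric.sum_metric_raise hy, h.symmQ y hy a b]
  ring

theorem curv_σμ (h : IsConnOn g Q S F A U) (hy : y ∈ U) (a b d : Fin n) :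
    curvMat (connMat g Q S F A) a b y (.inl ()) (.inr (.inl d)) = 0 := by
  rw [curvMat_entry]
  simp only [connMat, Matrix.of_apply, pd_neg, neg_mul, mul_sub, Finset.sum_neg_distrib,
    Finset.sum_sub_distrib, h.metric.sum_metric_raise hy]
  rw [h.metric.pd_metric hy a, h.metric.pd_metric hy b]
  have hA : A b d a y = A a d b y := by rw [h.symmA', h.symmA, h.symmA']
  simp only [h.metric.christoffel_symm _ a b, mul_comm (g _ _ y), hA]
  ring

theorem curv_σφ (h : IsConnOn g Q S F A U) (a b : Fin n) :
    curvMat (connMat g Q S F A) a b y (.inl ()) (.inr (.inr ())) = 0 := by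
  rw [curvMat_entry]
  simp [connMat, pd_const, h.metric.symm a b]

theorem curv_μφ (h : IsConnOn g Q S F A U) (a b c : Fin n) :
    curvMat (connMat g Q S F A) a b y (.inr (.inl c)) (.inr (.inr ())) = 0 := by
  have hA : A b a = A a b := funext fun e => funext fun y => h.symmA b a e y
  rw [curvMat_entry]
  simp [connMat, pd_const, h.metric.christoffel_symm _ a b, hA]

theorem curv_φφ (h : IsConnOn g Q S F A U) (hy : y ∈ U) (a b : Fin n) :
    curvMat (connMat g Q S F A) a b y (.inr (.inr ())) (.inr (.inr ())) = 0 := by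
  rw [curvMat_entry]
  simp [connMat, pd_const, h.symmS y hy a b]

theorem curv_φσ (h : IsConnOn g Q S F A U) (a b : Fin n) :
    curvMat (connMat g Q S F A) a b y (.inr (.inr ())) (.inl ()) = curvScal g Q S F a b y := by
  rw [curvMat_entry]
  simp only [connMat, Matrix.of_apply, pd_neg, neg_mul, Finset.sum_neg_distrib, sum_mul_raise,
    curvScal, nabla1, h.metric.christoffel_symm _ a b]
  ring

theorem curv_φμ (h : IsConnOn g Q S F A U) (a b d : Fin n) :
    curvMat (connMat g Q S F A) a b y (.inr (.inr ())) (.inr (.inl d))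
      = curvForm g S F A a b d y := by
  rw [curvMat_entry]
  simp only [connMat, Matrix.of_apply, pd_neg, neg_mul, mul_sub, Finset.sum_neg_distrib,
    Finset.sum_sub_distrib, sum_mul_raise, curvForm, nabla2, h.metric.christoffel_symm _ a b,
    mul_comm (S _ _ y) (christoffel _ _ _ _ _)]
  ring

/-- Lowering the output index trades derivatives of raised tensors for covariant derivatives of `Q`;
no information is lost, by `eq_zero_of_lower`. -/
theorem lower_curv_μσ (h : IsConnOn g Q S F A U) (hy : y ∈ U) (a b e : Fin n) :
    ∑ c, g e c y * curvMat (connMat g Q S F A) a b y (.inr (.inl c)) (.inl ())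
      = curvVec g Q F A a b e y := by
  have hg := h.metric
  have h1 : ∀ c, curvMat (connMat g Q S F A) a b y (.inr (.inl c)) (.inl ())
      = nablaVec g (raise g (Q b)) a c y - nablaVec g (raise g (Q a)) b c y
        - (∑ m, raise g (A a m) c y * raise g (Q b) m y
          - ∑ m, raise g (A b m) c y * raise g (Q a) m y)
        - ((if a = c then 1 else 0) * F b y - (if b = c then 1 else 0) * F a y) := by
    intro c
    rw [curvMat_entry]
    simp only [connMat, Matrix.of_apply, sub_mul, Finset.sum_sub_distrib, nablaVec]
    change pd a (raise g (Q b) c) y - pd b (raise g (Q a) c) y + _ = _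
    ring
  have h2 : ∀ p q : Fin n, ∑ c, g e c y * ∑ m, raise g (A p m) c y * raise g (Q q) m y
      = tr g y fun m j => A p m e y * Q q j y := by
    intro p q
    rw [← sum_mul_raise]
    simp only [Finset.mul_sum]
    rw [Finset.sum_comm]
    refine Finset.sum_congr rfl fun m _ => ?_
    rw [← hg.sum_metric_raise hy (A p m) e, Finset.sum_mul]
    exact Finset.sum_congr rfl fun c _ => by ring
  have h3 : ∀ p : Fin n, ∀ x : ℝ, ∑ c, g e c y * ((if p = c then 1 else 0) * x) = g e p y * x := by
    intro p x; simp
  simp only [h1, mul_sub, Finset.sum_sub_distrib]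
  rw [hg.sum_metric_nablaVec_raise hy (h.smoothQ b), hg.sum_metric_nablaVec_raise hy (h.smoothQ a),
    h2, h2, h3, h3]
  simp only [curvVec, nabla1, nabla2, hg.christoffel_symm _ a b]
  ring

theorem lower_curv_μμ (h : IsConnOn g Q S F A U) (hy : y ∈ U) (a b e d : Fin n) :
    ∑ c, g e c y * curvMat (connMat g Q S F A) a b y (.inr (.inl c)) (.inr (.inl d))
      = curvEnd g Q S A a b e d y := by
  have hg := h.metric
  have hpd : ∀ p q c, pd p (fun z => christoffel g c q d z - raise g (A q d) c z) y
      = pd p (christoffel g c q d) y - pd p (raise g (A q d) c) y := fun p q c =>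
    pd_sub p (differentiableAt_of_smooth hg.isOpen hy (hg.smooth_christoffel c q d))
      (differentiableAt_of_smooth hg.isOpen hy (hg.smooth_raise (h.smoothA q d) c))
  -- Christoffel terms on the upper index complete `∂A` to `nablaVec`, and those on `d` are kept
  -- apart. The terms still missing from `∇A`, with symbols `Γ^m_ab`, cancel on skewing in `a, b`.
  have h1 : ∀ c, curvMat (connMat g Q S F A) a b y (.inr (.inl c)) (.inr (.inl d))
      = riemann g a b c d y
        - (nablaVec g (raise g (A b d)) a c y - ∑ m, raise g (A b m) c y * christoffel g m a d y)
        + (nablaVec g (raise g (A a d)) b c y - ∑ m, raise g (A a m) c y * christoffel g m b d y)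
        + (∑ m, raise g (A a m) c y * raise g (A b d) m y
          - ∑ m, raise g (A b m) c y * raise g (A a d) m y)
        - (raise g (Q a) c y * g b d y - raise g (Q b) c y * g a d y)
        - ((if a = c then 1 else 0) * S b d y - (if b = c then 1 else 0) * S a d y) := by
    intro c
    rw [curvMat_entry]
    simp only [connMat, Matrix.of_apply, sub_mul, mul_sub, Finset.sum_sub_distrib, nablaVec, hpd,
      riemann]
    ring
  have h2 : ∀ (p : Fin n) (x : Fin n → ℝ), ∑ c, g e c y * ∑ m, raise g (A p m) c y * x m
      = ∑ m, A p m e y * x m := by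
    intro p x
    simp only [Finset.mul_sum]
    rw [Finset.sum_comm]
    refine Finset.sum_congr rfl fun m _ => ?_
    rw [← hg.sum_metric_raise hy (A p m) e, Finset.sum_mul]
    exact Finset.sum_congr rfl fun c _ => by ring
  have h3 : ∀ p : Fin n, ∀ x : ℝ, ∑ c, g e c y * ((if p = c then 1 else 0) * x) = g e p y * x := by
    intro p x; simp
  have h4 : ∀ (p : Fin n) (x : ℝ), ∑ c, g e c y * (raise g (Q p) c y * x) = Q p e y * x := by
    intro p x
    rw [← hg.sum_metric_raise hy (Q p) e, Finset.sum_mul]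
    exact Finset.sum_congr rfl fun c _ => by ring
  simp only [h1, mul_sub, mul_add, Finset.sum_sub_distrib, Finset.sum_add_distrib]
  rw [hg.sum_metric_nablaVec_raise hy (h.smoothA b d),
    hg.sum_metric_nablaVec_raise hy (h.smoothA a d), h2, h2, h2, h2, h3, h3, h4, h4,
    sum_mul_raise, sum_mul_raise]
  simp only [curvEnd, riemannLow, nabla1, nabla3, hg.christoffel_symm _ a b,
    mul_comm (A _ _ _ y) (christoffel _ _ _ _ _)]
  ring

theorem eq_zero_of_lower (h : IsConnOn g Q S F A U) (hy : y ∈ U) {x : Fin n → ℝ}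
    (hx : ∀ e, ∑ c, g e c y * x c = 0) (c : Fin n) : x c = 0 := by
  have h1 : (gMat g y).mulVec x = 0 := funext hx
  have h2 := congrArg (invMat g y).mulVec h1
  rw [Matrix.mulVec_mulVec, h.metric.invMat_mul_gMat hy, Matrix.one_mulVec,
    Matrix.mulVec_zero] at h2
  exact congrFun h2 c

theorem curvMat_eq_zero_iff (h : IsConnOn g Q S F A U) (hy : y ∈ U) (a b : Fin n) :
    curvMat (connMat g Q S F A) a b y = 0 ↔
      (∀ e, curvVec g Q F A a b e y = 0) ∧ (∀ e d, curvEnd g Q S A a b e d y = 0) ∧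
      (∀ d, curvForm g S F A a b d y = 0) ∧ curvScal g Q S F a b y = 0 := by
  constructor
  · intro h0
    refine ⟨fun e => ?_, fun e d => ?_, fun d => ?_, ?_⟩
    · rw [← h.lower_curv_μσ hy, h0]; simp
    · rw [← h.lower_curv_μμ hy, h0]; simp
    · rw [← h.curv_φμ, h0]; rfl
    · rw [← h.curv_φσ, h0]; rfl
  · rintro ⟨h1, h2, h3, h4⟩
    ext i j
    rcases i with _ | i | _ <;> rcases j with _ | j | _
    · exact h.curv_σσ hy a b
    · exact h.curv_σμ hy a b j
    · exact h.curv_σφ a b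
    · exact h.eq_zero_of_lower hy (fun e => (h.lower_curv_μσ hy a b e).trans (h1 e)) i
    · exact h.eq_zero_of_lower hy (fun e => (h.lower_curv_μμ hy a b e j).trans (h2 e j)) i
    · exact h.curv_μφ a b i
    · exact (h.curv_φσ a b).trans h4
    · exact (h.curv_φμ a b j).trans (h3 j)
    · exact h.curv_φφ hy a b

end IsConnOn
end ConformalCodazzi

/-! ### The endomorphism part of the curvature: Gauss and Codazzi tensors -/

namespace ConformalCodazzi

variable {n : ℕ} {U : Set (Coord n)} {y : Coord n} {g P E G : Comp2 n} {F : Comp1 n} {A : Comp3 n}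

/-- The data of a conformal (Möbius) structure and of the tensors `E, G, F, A` on a coordinate
patch. -/
structure IsPatch (g P E G : Comp2 n) (F : Comp1 n) (A : Comp3 n) (U : Set (Coord n)) : Prop where
  two_le : 2 ≤ n
  metric : IsMetricOn g U
  smoothP : ∀ a b, ContDiffOn ℝ ∞ (P a b) U
  smoothE : ∀ a b, ContDiffOn ℝ ∞ (E a b) U
  smoothG : ∀ a b, ContDiffOn ℝ ∞ (G a b) U
  smoothF : ∀ a, ContDiffOn ℝ ∞ (F a) U
  smoothA : ∀ a b c, ContDiffOn ℝ ∞ (A a b c) U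
  symmP : ∀ y ∈ U, ∀ a b, P a b y = P b a y
  symmE : ∀ a b y, E a b y = E b a y
  symmG : ∀ a b y, G a b y = G b a y
  symmA : ∀ a b c y, A a b c y = A b a c y
  symmA' : ∀ a b c y, A a b c y = A a c b y
  trA : ∀ y ∈ U, ∀ c, tr g y (fun a b => A a b c y) = 0
  trEG : ∀ y ∈ U, tr g y (fun a b => E a b y) + tr g y (fun a b => G a b y) = 0
  tfEG : n = 2 → ∀ y ∈ U, ∀ a b, (E a b y - G a b y)
    - (1 / (n : ℝ)) * tr g y (fun c d => E c d y - G c d y) * g a b y = 0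
  schoutenP : 3 ≤ n → P = schouten g
  mobiusP : n = 2 → ∀ y ∈ U, tr g y (fun a b => P a b y) = (1 / 2) * scal g y

/-- Half the sum of two tensors. -/
noncomputable def halfSum (E G : Comp2 n) : Comp2 n := fun a b y => (E a b y + G a b y) / 2

/-- Half the difference of two tensors. -/
noncomputable def halfDiff (E G : Comp2 n) : Comp2 n := fun a b y => (E a b y - G a b y) / 2

/-- The part of the curvature component `μ → μ` which is skew in the last two indices. -/
noncomputable def gaussTensor (g P E G : Comp2 n) (A : Comp3 n) : Comp4 n := fun a b c d y =>
  weyl g P a b c d y + kn g (halfDiff E G) a b c d y + cubicCurv g A a b c d y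

/-- The part of the curvature component `μ → μ` which is symmetric in the last two indices. -/
noncomputable def codazziTensor (g N : Comp2 n) (A : Comp3 n) : Comp4 n := fun a b c d y =>
  -(nabla3 g A a b c d y - nabla3 g A b a c d y) + N a c y * g b d y - N b c y * g a d y
    - g c a y * N b d y + g c b y * N a d y

theorem cubicCurv_eq (g : Comp2 n) (A : Comp3 n) (a b c d : Fin n) (y : Coord n) :
    cubicCurv g A a b c d y = tr g y (fun ν τ => A ν c a y * A b d τ y)
      - tr g y fun ν τ => A ν c b y * A a d τ y := by
  simp only [cubicCurv, skew]; ring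

theorem kn_skew (g Q : Comp2 n) (a b c d : Fin n) (y : Coord n) :
    kn g Q a b c d y = -kn g Q b a c d y := by
  simp only [kn_eq]; ring

theorem kn_skew_right (g Q : Comp2 n) (a b c d : Fin n) (y : Coord n) :
    kn g Q a b c d y = -kn g Q a b d c y := by
  simp only [kn_eq]; ring

namespace IsPatch

theorem isConnOn (h : IsPatch g P E G F A U) :
    IsConnOn g (fun a b y => P a b y - E a b y) (fun a b y => P a b y + G a b y) F A U where
  metric := h.metric
  smoothQ a b := (h.smoothP a b).sub (h.smoothE a b)
  smoothS a b := (h.smoothP a b).add (h.smoothG a b)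
  smoothF := h.smoothF
  smoothA := h.smoothA
  symmQ y hy a b := by rw [h.symmP y hy, h.symmE]
  symmS y hy a b := by rw [h.symmP y hy, h.symmG]
  symmA := h.symmA
  symmA' := h.symmA'

theorem nabla3_symm (h : IsPatch g P E G F A U) (a b c d : Fin n) (y : Coord n) :
    nabla3 g A a b c d y = nabla3 g A a b d c y := by
  have hA : ∀ b c d, A b c d = A b d c := fun b c d => funext fun y => h.symmA' b c d y
  simp only [nabla3, hA b c d, hA _ c d, hA b _ d, hA b c]
  ring

theorem cubicCurv_skew_right (h : IsPatch g P E G F A U) (a b c d : Fin n) (y : Coord n) :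
    cubicCurv g A a b c d y = -cubicCurv g A a b d c y := by
  have key : ∀ a b c d : Fin n, tr g y (fun ν τ => A ν c a y * A b d τ y)
      = tr g y fun ν τ => A ν d b y * A a c τ y := by
    intro a b c d
    rw [← h.metric.tr_swap]
    congr 1; ext ν τ
    rw [h.symmA' τ c a, h.symmA τ a c, h.symmA' a τ c, h.symmA' b d ν, h.symmA b ν d,
      h.symmA' ν b d]
    ring
  rw [cubicCurv_eq, cubicCurv_eq, key a b c d, key b a c d]
  ring

theorem gaussTensor_skew (g P E G : Comp2 n) (A : Comp3 n) (a b c d : Fin n) (y : Coord n) :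
    gaussTensor g P E G A a b c d y = -gaussTensor g P E G A b a c d y := by
  simp only [gaussTensor, weyl, riemannLow_skew g a b, kn_skew g _ a b, cubicCurv_eq]
  ring

theorem gaussTensor_skew_right (h : IsPatch g P E G F A U) (hy : y ∈ U) (a b c d : Fin n) :
    gaussTensor g P E G A a b c d y = -gaussTensor g P E G A a b d c y := by
  simp only [gaussTensor, weyl, h.metric.riemannLow_skew_right hy a b c d,
    kn_skew_right g _ a b c d, h.cubicCurv_skew_right a b c d]
  ring

/-- With `X = P - V` one has `P - E = X - N` and `P + G = X + N`. The `X` terms form a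
Kulkarni-Nomizu product, which turns the Riemann tensor into the Weyl tensor plus the product with
`V`; the `N` terms enter symmetrically in the last two indices. -/
theorem curvEnd_eq (h : IsPatch g P E G F A U) (a b c d : Fin n) :
    curvEnd g (fun a b y => P a b y - E a b y) (fun a b y => P a b y + G a b y) A a b c d y
      = gaussTensor g P E G A a b c d y + codazziTensor g (halfSum E G) A a b c d y := by
  have hA : ∀ p m, A p m c y = A m c p y := fun p m => by rw [h.symmA, h.symmA']
  simp only [curvEnd, gaussTensor, codazziTensor, weyl, kn_eq, cubicCurv_eq, halfSum, halfDiff,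
    h.nabla3_symm _ _ d c, hA]
  rw [h.metric.symm d b, h.metric.symm d a]
  ring

theorem curvEnd_eq_zero_iff (h : IsPatch g P E G F A U) (hy : y ∈ U) :
    (∀ a b c d, curvEnd g (fun a b y => P a b y - E a b y) (fun a b y => P a b y + G a b y) A
      a b c d y = 0) ↔ (∀ a b c d, gaussTensor g P E G A a b c d y = 0) ∧
        ∀ a b c d, codazziTensor g (halfSum E G) A a b c d y = 0 := by
  have hs : ∀ a b c d, codazziTensor g (halfSum E G) A a b c d y
      = codazziTensor g (halfSum E G) A a b d c y := by
    intro a b c d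
    simp only [codazziTensor, h.nabla3_symm _ _ c d, h.metric.symm c _ y, h.metric.symm d _ y]
    ring
  constructor
  · intro h0
    -- Comparing the entries `c d` and `d c` separates the skew part from the symmetric part.
    have key := fun a b c d => (h.curvEnd_eq a b c d).symm.trans (h0 a b c d)
    constructor <;> intro a b c d
    · linarith [key a b c d, key a b d c, hs a b c d, h.gaussTensor_skew_right hy a b c d]
    · linarith [key a b c d, key a b d c, hs a b c d, h.gaussTensor_skew_right hy a b c d]
  · rintro ⟨h1, h2⟩ a b c d
    rw [h.curvEnd_eq, h1, h2, add_zero]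

/-- One of the two quadratic terms contains a trace of `A` and drops out; total symmetry identifies
the other with `sqTensor`. -/
theorem ricciOf_cubicCurv (h : IsPatch g P E G F A U) (hy : y ∈ U) (b d : Fin n) :
    ricciOf g (cubicCurv g A) b d y = -sqTensor g A b d y := by
  simp only [ricciOf, cubicCurv_eq]
  rw [tr_sub]
  have h1 : tr g y (fun a c => tr g y fun ν τ => A ν c a y * A b d τ y) = 0 := by
    rw [tr_comm]
    have : ∀ ν, tr g y (fun a c => A ν c a y) = 0 := fun ν => by
      rw [h.metric.tr_swap, ← h.trA y hy ν]
      congr 1; ext i j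
      rw [h.symmA ν i j, h.symmA' i ν j]
    simp only [tr_mul_right, this, zero_mul, tr_zero]
  have h2 : tr g y (fun a c => tr g y fun ν τ => A ν c b y * A a d τ y) = sqTensor g A b d y := by
    rw [← h.metric.tr_swap]
    simp only [sqTensor]
    congr 1; ext μ ρ
    rw [← h.metric.tr_swap (fun ν τ => A b μ ν y * A d ρ τ y)]
    rw [← h.metric.tr_swap]
    congr 1; ext ν τ
    rw [h.symmA' τ μ b, h.symmA τ b μ, h.symmA' b τ μ, h.symmA ρ d ν]
  rw [h1, h2, zero_sub]

theorem tr_halfSum (h : IsPatch g P E G F A U) (hy : y ∈ U) :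
    tr g y (fun a b => halfSum E G a b y) = 0 := by
  have h1 := h.trEG y hy
  simp only [halfSum, div_eq_mul_inv]
  rw [tr_mul_right, tr_add, h1, zero_mul]

theorem cast_facts (h : IsPatch g P E G F A U) : (n : ℝ) ≠ 0 ∧ (n : ℝ) - 1 ≠ 0 := by
  have : (2 : ℝ) ≤ n := by exact_mod_cast h.two_le
  constructor <;> intro h0 <;> linarith

theorem ricciOf_gaussTensor (h : IsPatch g P E G F A U) (hy : y ∈ U) (b d : Fin n) :
    ricciOf g (gaussTensor g P E G A) b d y = ricciOf g (weyl g P) b d y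
      + (((n : ℝ) - 2) * halfDiff E G b d y
        + g b d y * tr g y fun i j => halfDiff E G i j y) - sqTensor g A b d y := by
  have h1 := h.metric.ricciOf_kn hy (halfDiff E G) b d
  have h2 := h.ricciOf_cubicCurv hy b d
  simp only [ricciOf] at h1 h2
  simp only [ricciOf, gaussTensor]
  rw [tr_add, tr_add, h1, h2]
  ring

theorem PA_eq (hn : 3 ≤ n) (a b : Fin n) : PA g A a b y = (1 / ((n : ℝ) - 2)) *
    (sqTensor g A a b y - normSq g A y / (2 * ((n : ℝ) - 1)) * g a b y) := by
  rw [PA, if_neg (by omega)]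

theorem tr_PA (h : IsPatch g P E G F A U) (hy : y ∈ U) (hn : 3 ≤ n) :
    tr g y (fun a b => PA g A a b y) = normSq g A y / (2 * ((n : ℝ) - 1)) := by
  have h3 : (3 : ℝ) ≤ n := by exact_mod_cast hn
  have h1 : (n : ℝ) - 2 ≠ 0 := by intro h; linarith
  have h2 : (n : ℝ) - 1 ≠ 0 := by intro h; linarith
  simp only [PA_eq hn]
  rw [tr_mul_left, tr_sub, tr_mul_left, h.metric.tr_metric hy]
  change 1 / ((n : ℝ) - 2) * (normSq g A y - _) = _
  field_simp
  ring

theorem tfCurv_cubicCurv (h : IsPatch g P E G F A U) (hy : y ∈ U) (hn : 3 ≤ n) (a b c d : Fin n) :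
    tfCurv g (cubicCurv g A) a b c d y
      = cubicCurv g A a b c d y + kn g (PA g A) a b c d y := by
  have h1 : tr g y (fun i j => ricciOf g (cubicCurv g A) i j y) = -normSq g A y := by
    simp only [h.ricciOf_cubicCurv hy]
    rw [tr_neg]; rfl
  simp only [tfCurv, kn_eq, PA_eq hn, h1]
  simp only [h.ricciOf_cubicCurv hy]
  ring

/-- The Weyl tensor is trace-free, so the Ricci contraction of the Gauss tensor is an equation for
`V` alone, with solution `P^A`. With this `V` the Gauss tensor is already trace-free. -/
theorem gaussTensor_eq_zero_iff_of_three_le (h : IsPatch g P E G F A U) (hy : y ∈ U)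
    (hn : 3 ≤ n) :
    (∀ a b c d, gaussTensor g P E G A a b c d y = 0) ↔
      (∀ a b, halfDiff E G a b y = PA g A a b y) ∧
      (4 ≤ n → ∀ a b c d, tfCurv g (cubicCurv g A) a b c d y + weyl g P a b c d y = 0) := by
  have h3 : (3 : ℝ) ≤ n := by exact_mod_cast hn
  have hn2 : (n : ℝ) - 2 ≠ 0 := by intro h; linarith
  have hn1 : (n : ℝ) - 1 ≠ 0 := by intro h; linarith
  have hW : ∀ b d, ricciOf g (weyl g P) b d y = 0 := by
    rw [h.schoutenP hn]; exact h.metric.ricciOf_weyl hy hn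
  have hR := h.ricciOf_gaussTensor hy
  simp only [hW, zero_add] at hR
  have heq : (∀ a b, halfDiff E G a b y = PA g A a b y) → ∀ a b c d,
      gaussTensor g P E G A a b c d y
        = tfCurv g (cubicCurv g A) a b c d y + weyl g P a b c d y := by
    intro hU a b c d
    rw [h.tfCurv_cubicCurv hy hn, gaussTensor, kn_eq, kn_eq]
    simp only [hU]
    ring
  constructor
  · intro h0
    have hR0 : ∀ b d, ricciOf g (gaussTensor g P E G A) b d y = 0 := fun b d => by
      simp only [ricciOf, h0, tr_zero]
    have hU : ∀ a b, halfDiff E G a b y = PA g A a b y := by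
      -- The contraction reads `(n - 2) V = A² - (tr V) g`; tracing it once more gives `tr V`, and
      -- substituting back gives `V`.
      have e1 : ∀ b d, ((n : ℝ) - 2) * halfDiff E G b d y
          = sqTensor g A b d y - (tr g y fun i j => halfDiff E G i j y) * g b d y := fun b d => by
        linarith [hR b d, hR0 b d]
      have e2 : tr g y (fun b d => ((n : ℝ) - 2) * halfDiff E G b d y)
          = normSq g A y - (tr g y fun i j => halfDiff E G i j y) * n := by
        simp only [e1]
        rw [tr_sub, tr_mul_left, h.metric.tr_metric hy]; rfl
      rw [tr_mul_left] at e2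
      have e3 : tr g y (fun i j => halfDiff E G i j y) = normSq g A y / (2 * ((n : ℝ) - 1)) := by
        field_simp
        linarith
      intro a b
      have e4 := e1 a b
      rw [e3] at e4
      rw [PA_eq hn, ← e4]
      field_simp
    exact ⟨hU, fun _ a b c d => (heq hU a b c d).symm.trans (h0 a b c d)⟩
  · rintro ⟨hU, hG⟩ a b c d
    rcases Nat.lt_or_ge 3 n with hn4 | hn3
    · exact (heq hU a b c d).trans (hG hn4 a b c d)
    -- For `n = 3` there is no Gauss condition at this level: a trace-free tensor with these
    -- symmetries is zero.
    · refine h.metric.eq_zero_of_tr_of_three hy (by omega)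
        (fun a b c d => gaussTensor g P E G A a b c d y)
        (fun a b c d => gaussTensor_skew g P E G A a b c d y)
        (fun a b c d => h.gaussTensor_skew_right hy a b c d) (fun b d => ?_) a b c d
      have := hR b d
      simp only [hU, h.tr_PA hy hn] at this
      rw [PA_eq hn] at this
      change ricciOf g (gaussTensor g P E G A) b d y = 0
      rw [this]
      field_simp
      ring

/-- In dimension two only the double trace counts. The Möbius condition `tr P = scal / 2` removes
the Weyl term from it, and the assumption on `tf (E - G)` makes `V` a multiple of `g`, so the
remaining equation `2 tr V = |A|²` determines `V`. -/
theorem gaussTensor_eq_zero_iff_of_two (h : IsPatch g P E G F A U) (hy : y ∈ U) (hn : n = 2) :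
    (∀ a b c d, gaussTensor g P E G A a b c d y = 0) ↔
      ∀ a b, halfDiff E G a b y = PA g A a b y := by
  have hn' : (n : ℝ) = 2 := by exact_mod_cast hn
  have htf : ∀ a b, halfDiff E G a b y
      = (1 / 2) * (tr g y fun i j => halfDiff E G i j y) * g a b y := by
    intro a b
    have h1 := h.tfEG hn y hy a b
    have h2 : tr g y (fun i j => halfDiff E G i j y)
        = (1 / 2) * tr g y (fun c d => E c d y - G c d y) := by
      rw [← tr_mul_left]
      congr 1; ext i j; simp only [halfDiff]; ring
    rw [h2, halfDiff]
    rw [hn'] at h1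
    linarith
  have hW : tr g y (fun b d => ricciOf g (weyl g P) b d y) = 0 := by
    have e1 := h.metric.ricciOf_riemannLow hy
    have e2 := h.metric.ricciOf_kn hy P
    simp only [ricciOf] at e1 e2
    simp only [ricciOf, weyl, tr_sub, e1, e2, hn', sub_self, zero_mul, zero_add, h.mobiusP hn y hy,
      tr_mul_right, h.metric.tr_metric hy]
    change scal g y - _ = 0
    ring
  have hRR : tr g y (fun b d => ricciOf g (gaussTensor g P E G A) b d y)
      = 2 * tr g y (fun i j => halfDiff E G i j y) - normSq g A y := by
    simp only [h.ricciOf_gaussTensor hy, tr_sub, tr_add, hW, hn', sub_self, zero_mul, zero_add,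
      tr_mul_right, h.metric.tr_metric hy]
    rfl
  constructor
  · intro h0 a b
    have h1 : tr g y (fun b d => ricciOf g (gaussTensor g P E G A) b d y) = 0 := by
      simp only [ricciOf, h0, tr_zero]
    rw [htf, PA, if_pos hn]
    rw [h1] at hRR
    linear_combination (-(1 / 4) * g a b y) * hRR
  · intro hU a b c d
    refine h.metric.eq_zero_of_tr_tr_of_two hy hn (fun a b c d => gaussTensor g P E G A a b c d y)
      (fun a b c d => gaussTensor_skew g P E G A a b c d y)
      (fun a b c d => h.gaussTensor_skew_right hy a b c d) ?_ a b c d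
    change tr g y (fun b d => ricciOf g (gaussTensor g P E G A) b d y) = 0
    have : tr g y (fun i j => halfDiff E G i j y) = (1 / 2) * normSq g A y := by
      simp only [hU, PA, if_pos hn]
      rw [tr_mul_left, h.metric.tr_metric hy, hn']
      ring
    rw [hRR, this]
    ring

/-- Trace-freeness is preserved by `∇`: `pd_tr` applies with `c` frozen, and the Christoffel
correction for `c` is again a trace of `A`. -/
theorem tr_nabla3 (h : IsPatch g P E G F A U) (hy : y ∈ U) (a c : Fin n) :
    tr g y (fun b d => nabla3 g A a b d c y) = 0 := by
  have h1 := h.metric.pd_tr hy (T := fun b d => A b d c) (fun b d => h.smoothA b d c) a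
  rw [pd_congr a h.metric.isOpen hy (g := fun _ => 0) fun z hz => h.trA z hz c, pd_const] at h1
  have h2 : ∀ b d, nabla3 g A a b d c y = nabla2 g (fun b d => A b d c) a b d y
      - ∑ m, christoffel g m a c y * A b d m y := fun b d => rfl
  simp only [h2]
  rw [tr_sub, ← h1, tr_sum]
  simp only [tr_mul_left, h.trA y hy, mul_zero, Finset.sum_const_zero, sub_zero]

/-- The assumption that `E` and `G` have opposite traces enters here, removing the `tr N` term. -/
theorem tr_codazziTensor (h : IsPatch g P E G F A U) (hy : y ∈ U) (a c : Fin n) :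
    tr g y (fun b d => codazziTensor g (halfSum E G) A a b c d y)
      = div1 g A a c y + n * halfSum E G a c y := by
  have hg := h.metric
  have e1 : tr g y (fun b d => nabla3 g A a b c d y) = 0 := by
    simp only [h.nabla3_symm a _ c]
    exact h.tr_nabla3 hy a c
  have e2 := hg.tr_metric_mul' hy a fun b => halfSum E G b c y
  have e3 := hg.tr_metric_mul hy c fun d => halfSum E G a d y
  have e4 : tr g y (fun b d => halfSum E G b c y * g a d y) = halfSum E G a c y := by
    simpa only [mul_comm] using e2
  simp only [codazziTensor]
  rw [tr_add, tr_sub, tr_sub, tr_add, tr_neg, tr_sub, tr_mul_left, tr_mul_left, e1, e3, e4,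
    hg.tr_metric hy, h.tr_halfSum hy]
  change -(0 - div1 g A a c y) + _ - _ - _ + _ = _
  ring

theorem codazziTensor_skew (g N : Comp2 n) (A : Comp3 n) (a b c d : Fin n) (y : Coord n) :
    codazziTensor g N A a b c d y = -codazziTensor g N A b a c d y := by
  simp only [codazziTensor]; ring

theorem codazziTensor_eq_zero_iff (h : IsPatch g P E G F A U) (hy : y ∈ U) :
    (∀ a b c d, codazziTensor g (halfSum E G) A a b c d y = 0) ↔
      (∀ a b, halfSum E G a b y = -(1 / (n : ℝ)) * div1 g A a b y) ∧
      (3 ≤ n → ∀ a b c d, skew (fun a b => nabla3 g A a b c d y) a b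
        - (1 / (n : ℝ)) * (skew (fun a b => g d a y * div1 g A b c y) a b
          + skew (fun a b => g c a y * div1 g A b d y) a b) = 0) := by
  have hn0 := h.cast_facts.1
  have heq : (∀ a b, halfSum E G a b y = -(1 / (n : ℝ)) * div1 g A a b y) → ∀ a b c d,
      codazziTensor g (halfSum E G) A a b c d y
        = -2 * (skew (fun a b => nabla3 g A a b c d y) a b
        - (1 / (n : ℝ)) * (skew (fun a b => g d a y * div1 g A b c y) a b
          + skew (fun a b => g c a y * div1 g A b d y) a b)) := by
    intro hN a b c d
    simp only [codazziTensor, hN, skew, h.metric.symm d _ y]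
    ring
  constructor
  · intro h0
    have hN : ∀ a b, halfSum E G a b y = -(1 / (n : ℝ)) * div1 g A a b y := by
      intro a b
      have := h.tr_codazziTensor hy a b
      simp only [h0, tr_zero] at this
      field_simp
      linarith
    refine ⟨hN, fun _ a b c d => ?_⟩
    have := heq hN a b c d
    rw [h0] at this
    linarith
  · rintro ⟨hN, hC⟩ a b c d
    rcases Nat.lt_or_ge 2 n with hn3 | hn2
    · rw [heq hN, hC hn3, mul_zero]
    -- For `n = 2` and fixed `c`, a tensor skew in `a, b` is determined by its contraction over `b,
    -- d`, so the value of `N` already suffices.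
    · refine h.metric.eq_zero_of_tr_of_two hy (le_antisymm hn2 h.two_le)
        (fun a b d => codazziTensor g (halfSum E G) A a b c d y)
        (fun a b d => codazziTensor_skew g _ A a b c d y) (fun a => ?_) a b d
      rw [h.tr_codazziTensor hy, hN]
      field_simp
      ring

end IsPatch
end ConformalCodazzi

/-! ### Consequences of the Bianchi identity -/

namespace ConformalCodazzi

variable {n : ℕ} {U : Set (Coord n)} {y : Coord n} {g Q S P E G : Comp2 n} {F : Comp1 n}
  {A : Comp3 n}

theorem curvVec_skew (g Q : Comp2 n) (F : Comp1 n) (A : Comp3 n) (a b e : Fin n) (y : Coord n) :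
    curvVec g Q F A a b e y = -curvVec g Q F A b a e y := by
  simp only [curvVec]; ring

theorem curvForm_skew (g S : Comp2 n) (F : Comp1 n) (A : Comp3 n) (a b e : Fin n) (y : Coord n) :
    curvForm g S F A a b e y = -curvForm g S F A b a e y := by
  simp only [curvForm]; ring

namespace IsConnOn

/-- If one entry of the curvature vanishes on the open set `U`, so do its derivatives, and the
Bianchi identity in that entry becomes an algebraic relation among the others. -/
theorem bianchi_entry (h : IsConnOn g Q S F A U) (hy : y ∈ U) (a b e : Fin n) (i j : TIdx n) :
    let K := curvMat (connMat g Q S F A)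
    (∀ p q, ∀ z ∈ U, K p q z i j = 0) →
      (∑ k, connMat g Q S F A e y i k * K a b y k j - ∑ k, K a b y i k * connMat g Q S F A e y k j)
      + (∑ k, connMat g Q S F A a y i k * K b e y k j
        - ∑ k, K b e y i k * connMat g Q S F A a y k j)
      + (∑ k, connMat g Q S F A b y i k * K e a y k j
        - ∑ k, K e a y i k * connMat g Q S F A b y k j) = 0 := by
  intro K hK
  have hb := congrFun (congrFun (bianchi_curvMat h.metric.isOpen hy h.smoothMat_connMat a b e) i) j
  have hpd : ∀ c p q, pdM c (K p q) y i j = 0 := fun c p q => by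
    change pd c (fun z => K p q z i j) y = 0
    rw [pd_congr c h.metric.isOpen hy (hK p q), pd_const]
  simp only [Matrix.add_apply, Matrix.sub_apply, Matrix.mul_apply, Matrix.zero_apply] at hb
  rw [hpd, hpd, hpd] at hb
  simpa only [zero_add] using hb

theorem curv_μμ_eq_zero (h : IsConnOn g Q S F A U) (hy : y ∈ U)
    (h0 : ∀ a b e d, curvEnd g Q S A a b e d y = 0) (a b c d : Fin n) :
    curvMat (connMat g Q S F A) a b y (.inr (.inl c)) (.inr (.inl d)) = 0 :=
  h.eq_zero_of_lower hy (x := fun c => curvMat (connMat g Q S F A) a b y (.inr (.inl c))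
    (.inr (.inl d))) (fun e => (h.lower_curv_μμ hy a b e d).trans (h0 a b e d)) c

theorem curv_μσ_eq_zero (h : IsConnOn g Q S F A U) (hy : y ∈ U)
    (h0 : ∀ a b e, curvVec g Q F A a b e y = 0) (a b c : Fin n) :
    curvMat (connMat g Q S F A) a b y (.inr (.inl c)) (.inl ()) = 0 :=
  h.eq_zero_of_lower hy (x := fun c => curvMat (connMat g Q S F A) a b y (.inr (.inl c))
    (.inl ())) (fun e => (h.lower_curv_μσ hy a b e).trans (h0 a b e)) c

/-- The Bianchi identity in the component `μ → μ`, when that component of the curvature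
vanishes. -/
theorem bianchi_μμ (h : IsConnOn g Q S F A U) (hy : y ∈ U)
    (h0 : ∀ z ∈ U, ∀ a b e d, curvEnd g Q S A a b e d z = 0) (a b e f d : Fin n) :
    (g f e y * curvForm g S F A a b d y + curvVec g Q F A a b f y * g e d y)
      + (g f a y * curvForm g S F A b e d y + curvVec g Q F A b e f y * g a d y)
      + (g f b y * curvForm g S F A e a d y + curvVec g Q F A e a f y * g b d y) = 0 := by
  have hμμ := fun z (hz : z ∈ U) => h.curv_μμ_eq_zero hz (h0 z hz)
  have key : ∀ c, ((if e = c then 1 else 0) * curvForm g S F A a b d y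
      + curvMat (connMat g Q S F A) a b y (.inr (.inl c)) (.inl ()) * g e d y)
      + ((if a = c then 1 else 0) * curvForm g S F A b e d y
      + curvMat (connMat g Q S F A) b e y (.inr (.inl c)) (.inl ()) * g a d y)
      + ((if b = c then 1 else 0) * curvForm g S F A e a d y
      + curvMat (connMat g Q S F A) e a y (.inr (.inl c)) (.inl ()) * g b d y) = 0 := by
    intro c
    -- The surviving products are `δ_e^c` with the entry `μ → φ`, and the entry `σ → μ` with `-g`,
    -- together with their cyclic images.
    have hb := h.bianchi_entry hy a b e (.inr (.inl c)) (.inr (.inl d))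
      fun p q z hz => hμμ z hz p q c d
    simp only [Fintype.sum_sum_type, Finset.univ_unique, Finset.sum_singleton, PUnit.default_eq_unit,
      h.curv_σμ hy, h.curv_μφ, hμμ y hy, h.curv_φμ, mul_zero, zero_mul, Finset.sum_const_zero,
      zero_add, add_zero] at hb
    simp only [connMat, Matrix.of_apply] at hb
    linear_combination hb
  have hl : ∀ p : Fin n, ∀ x : ℝ, ∑ c, g f c y * ((if p = c then 1 else 0) * x) = g f p y * x := by
    intro p x; simp
  have hk : ∀ (p q : Fin n) (x : ℝ), ∑ c, g f c y
      * (curvMat (connMat g Q S F A) p q y (.inr (.inl c)) (.inl ()) * x)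
      = curvVec g Q F A p q f y * x := by
    intro p q x
    rw [← h.lower_curv_μσ hy, Finset.sum_mul]
    exact Finset.sum_congr rfl fun c _ => by ring
  have hsum := Finset.sum_congr rfl fun c (_ : c ∈ Finset.univ) => congrArg (g f c y * ·) (key c)
  simp only [mul_add, Finset.sum_add_distrib, hl, hk, mul_zero, Finset.sum_const_zero] at hsum
  exact hsum

/-- If only the component `σ → φ` of the curvature is left, then it vanishes for `n ≥ 3`. -/
theorem curvScal_eq_zero (h : IsConnOn g Q S F A U) (hn : 3 ≤ n) (hy : y ∈ U)
    (h0 : ∀ z ∈ U, ∀ a b e d, curvEnd g Q S A a b e d z = 0)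
    (h1 : ∀ z ∈ U, ∀ a b e, curvVec g Q F A a b e z = 0) (a b : Fin n) :
    curvScal g Q S F a b y = 0 := by
  -- With a third index `e`, the Kronecker deltas of `a` and `b` against `e` vanish, so the cyclic
  -- sum in the entry `σ → μ^e` reduces to `curvScal` at `a, b`.
  obtain ⟨e, he⟩ : ∃ e, e ∉ ({a, b} : Finset (Fin n)) := by
    by_contra! hall
    have h2 : (Finset.univ : Finset (Fin n)).card ≤ ({a, b} : Finset (Fin n)).card :=
      Finset.card_le_card fun e _ => hall e
    have h3 := Finset.card_le_two (a := a) (b := b)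
    rw [Finset.card_univ, Fintype.card_fin] at h2
    omega
  simp only [Finset.mem_insert, Finset.mem_singleton, not_or] at he
  have hb := h.bianchi_entry hy a b e (.inr (.inl e)) (.inl ())
    fun p q z hz => h.curv_μσ_eq_zero hz (h1 z hz) p q e
  simp only [Fintype.sum_sum_type, Finset.univ_unique, Finset.sum_singleton, PUnit.default_eq_unit,
    h.curv_σσ hy, h.curv_μφ, h.curv_μμ_eq_zero hy (h0 y hy), h.curv_μσ_eq_zero hy (h1 y hy),
    h.curv_φσ, mul_zero, zero_mul, Finset.sum_const_zero, zero_add, add_zero] at hb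
  simpa [connMat, Ne.symm he.1, Ne.symm he.2] using hb

theorem curvVec_add_curvForm_eq_zero (h : IsConnOn g Q S F A U) (hn : 2 ≤ n) (hy : y ∈ U)
    (h0 : ∀ z ∈ U, ∀ a b e d, curvEnd g Q S A a b e d z = 0)
    (ht : ∀ a, tr g y (fun b c => curvVec g Q F A a b c y + curvForm g S F A a b c y) = 0)
    (a b d : Fin n) : curvVec g Q F A a b d y + curvForm g S F A a b d y = 0 := by
  have hg := h.metric
  set x : Fin n → Fin n → Fin n → ℝ := fun a b c =>
    curvVec g Q F A a b c y + curvForm g S F A a b c y with hx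
  have hskew : ∀ a b c, x a b c = -x b a c := fun a b c => by
    simp only [hx, curvVec_skew g Q F A a b, curvForm_skew g S F A a b]; ring
  -- Symmetrizing the Bianchi relation in `f, d` makes the two mixed entries appear only through
  -- their sum `x`.
  have hsum : ∀ e f, g f e y * x a b d + g e d y * x a b f + g f a y * x b e d
      + g a d y * x b e f + g f b y * x e a d + g b d y * x e a f = 0 := by
    intro e f
    have h1 := h.bianchi_μμ hy h0 a b e f d
    have h2 := h.bianchi_μμ hy h0 a b e d f
    simp only [hx]
    rw [hg.symm d e, hg.symm d a, hg.symm d b] at h2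
    rw [hg.symm e f, hg.symm a f, hg.symm b f] at h2
    linear_combination h1 + h2
  have e1 : tr g y (fun e f => g f e y * x a b d) = n * x a b d := by
    rw [tr_mul_right, hg.tr_swap fun e f => g e f y, hg.tr_metric hy]
  have e2 : tr g y (fun e f => g e d y * x a b f) = x a b d := by
    simp only [hg.symm _ d]
    exact hg.tr_metric_mul hy d fun f => x a b f
  have e3 : tr g y (fun e f => g f a y * x b e d) = x b a d := by
    simp only [hg.symm _ a]
    exact hg.tr_metric_mul' hy a fun e => x b e d
  have e4 : tr g y (fun e f => g f b y * x e a d) = x b a d := by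
    simp only [hg.symm _ b]
    exact hg.tr_metric_mul' hy b fun e => x e a d
  have e5 : tr g y (fun e f => x e a f) = 0 := by
    simp only [hskew _ a]
    rw [tr_neg, ht, neg_zero]
  have htot : tr g y (fun e f => g f e y * x a b d + g e d y * x a b f + g f a y * x b e d
      + g a d y * x b e f + g f b y * x e a d + g b d y * x e a f) = 0 := by
    simp only [hsum, tr_zero]
  rw [tr_add, tr_add, tr_add, tr_add, tr_add, tr_mul_left, tr_mul_left, e1, e2, e3, e4, e5, ht b,
    hskew b a d] at htot
  have hn' : (2 : ℝ) ≤ n := by exact_mod_cast hn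
  -- Contracting over `e, f` gives the coefficient `n + 1 - 1 - 1`; the other terms are traces of
  -- `x`.
  have : ((n : ℝ) - 1) * x a b d = 0 := by linear_combination htot
  exact (mul_eq_zero.1 this).resolve_left (by intro h3; linarith)

theorem curvVec_eq_zero (h : IsConnOn g Q S F A U) (hn : 4 ≤ n) (hy : y ∈ U)
    (h0 : ∀ z ∈ U, ∀ a b e d, curvEnd g Q S A a b e d z = 0)
    (h1 : ∀ a b d, curvVec g Q F A a b d y + curvForm g S F A a b d y = 0)
    (a b d : Fin n) : curvVec g Q F A a b d y = 0 := by
  have hg := h.metric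
  have hn' : (4 : ℝ) ≤ n := by exact_mod_cast hn
  set x : Fin n → Fin n → Fin n → ℝ := fun a b c => curvVec g Q F A a b c y with hx
  set v : Fin n → ℝ := fun b => tr g y fun e f => x b e f with hv
  have hskew : ∀ a b c, x a b c = -x b a c := fun a b c => curvVec_skew g Q F A a b c y
  -- The contraction over `e, f` of the Bianchi relation with `curvForm = -curvVec`. For `n = 3` the
  -- leading coefficient vanishes, which is why the Gauss equation there is a condition on this
  -- component.
  have key : ∀ a b d, (3 - (n : ℝ)) * x a b d + g a d y * v b - g b d y * v a = 0 := by
    intro a b d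
    have hsum : ∀ e f, x a b f * g e d y - g f e y * x a b d + g a d y * x b e f
        - g f a y * x b e d + g b d y * x e a f - g f b y * x e a d = 0 := by
      intro e f
      have h2 := h.bianchi_μμ hy h0 a b e f d
      simp only [fun a b d => eq_neg_of_add_eq_zero_right (h1 a b d)] at h2
      linear_combination h2
    have e1 : tr g y (fun e f => g f e y * x a b d) = n * x a b d := by
      rw [tr_mul_right, hg.tr_swap fun e f => g e f y, hg.tr_metric hy]
    have e2 : tr g y (fun e f => x a b f * g e d y) = x a b d := by
      simp only [hg.symm _ d, mul_comm (x _ _ _)]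
      exact hg.tr_metric_mul hy d fun f => x a b f
    have e3 : tr g y (fun e f => g f a y * x b e d) = x b a d := by
      simp only [hg.symm _ a]
      exact hg.tr_metric_mul' hy a fun e => x b e d
    have e4 : tr g y (fun e f => g f b y * x e a d) = x b a d := by
      simp only [hg.symm _ b]
      exact hg.tr_metric_mul' hy b fun e => x e a d
    have e5 : tr g y (fun e f => x e a f) = -v a := by
      simp only [hskew _ a]
      rw [tr_neg]
    have htot : tr g y (fun e f => x a b f * g e d y - g f e y * x a b d + g a d y * x b e f
        - g f a y * x b e d + g b d y * x e a f - g f b y * x e a d) = 0 := by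
      simp only [hsum, tr_zero]
    rw [tr_sub, tr_add, tr_sub, tr_add, tr_sub, tr_mul_left, tr_mul_left, e1, e2, e3, e4, e5,
      hskew b a d] at htot
    linear_combination htot
  -- A further contraction over `b, d` gives `(4 - 2n) v = 0`.
  have hv0 : ∀ a, v a = 0 := by
    intro a
    have htot : tr g y (fun b d => (3 - (n : ℝ)) * x a b d + g a d y * v b - g b d y * v a) = 0 := by
      simp only [key, tr_zero]
    have e1 := hg.tr_metric_mul' hy a v
    rw [tr_sub, tr_add, tr_mul_left, tr_mul_right, hg.tr_metric hy, e1] at htot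
    have : (4 - 2 * (n : ℝ)) * v a = 0 := by linear_combination htot
    exact (mul_eq_zero.1 this).resolve_left (by intro h3; linarith)
  have h4 := key a b d
  rw [hv0, hv0, mul_zero, mul_zero, add_zero, sub_zero] at h4
  exact (mul_eq_zero.1 h4).resolve_left (by intro h3; linarith)

end IsConnOn
end ConformalCodazzi

/-! ### Sum and difference of the mixed curvature components -/

namespace ConformalCodazzi

variable {n : ℕ} {U : Set (Coord n)} {y : Coord n} {g P E G : Comp2 n} {F : Comp1 n} {A : Comp3 n}

/-- Half the sum of the curvature components `σ → μ` and `μ → φ`, in terms of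
`N = (E + G) / 2` and `X = P - (E - G) / 2`. -/
noncomputable def curvMean (g N X : Comp2 n) (F : Comp1 n) (A : Comp3 n) (a b c : Fin n)
    (y : Coord n) : ℝ :=
  F a y * g b c y - F b y * g a c y - (nabla2 g N a b c y - nabla2 g N b a c y)
    + (tr g y (fun m j => A b c m y * X a j y) - tr g y fun m j => A a c m y * X b j y)

/-- Half the difference of the curvature components `σ → μ` and `μ → φ`, in terms of
`N = (E + G) / 2` and `V = (E - G) / 2`. -/
noncomputable def curvDev (g P N V : Comp2 n) (A : Comp3 n) (a b c : Fin n) (y : Coord n) : ℝ :=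
  nabla2 g P a b c y - nabla2 g P b a c y - (nabla2 g V a b c y - nabla2 g V b a c y)
    + (tr g y (fun m j => A a c m y * N b j y) - tr g y fun m j => A b c m y * N a j y)

section Nabla

theorem nabla2_add {S T : Comp2 n} (a b c : Fin n) (hS : DifferentiableAt ℝ (S b c) y)
    (hT : DifferentiableAt ℝ (T b c) y) :
    nabla2 g (fun a b y => S a b y + T a b y) a b c y = nabla2 g S a b c y + nabla2 g T a b c y := by
  simp only [nabla2, mul_add, Finset.sum_add_distrib]
  rw [pd_add a hS hT]
  ring

theorem nabla2_sub {S T : Comp2 n} (a b c : Fin n) (hS : DifferentiableAt ℝ (S b c) y)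
    (hT : DifferentiableAt ℝ (T b c) y) :
    nabla2 g (fun a b y => S a b y - T a b y) a b c y = nabla2 g S a b c y - nabla2 g T a b c y := by
  simp only [nabla2, mul_sub, Finset.sum_sub_distrib]
  rw [pd_sub a hS hT]
  ring

theorem nabla2_const_mul {T : Comp2 n} (r : ℝ) (a b c : Fin n)
    (hT : DifferentiableAt ℝ (T b c) y) :
    nabla2 g (fun a b y => r * T a b y) a b c y = r * nabla2 g T a b c y := by
  simp only [nabla2, mul_left_comm _ r, ← Finset.mul_sum]
  rw [pd_const_mul a r hT]
  ring

theorem nabla2_congr {S T : Comp2 n} (hU : IsOpen U) (hy : y ∈ U)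
    (h : ∀ z ∈ U, ∀ b c, S b c z = T b c z) (a b c : Fin n) :
    nabla2 g S a b c y = nabla2 g T a b c y := by
  simp only [nabla2, h y hy, pd_congr a hU hy fun z hz => h z hz b c]

theorem IsMetricOn.nabla2_mul_metric (hg : IsMetricOn g U) (hy : y ∈ U) {f : Coord n → ℝ}
    (hf : ContDiffOn ℝ ∞ f U) (a b c : Fin n) :
    nabla2 g (fun b c y => f y * g b c y) a b c y = pd a f y * g b c y := by
  have h1 := hg.nabla2_metric hy a b c
  simp only [nabla2] at h1
  simp only [nabla2, mul_left_comm _ (f y), ← Finset.mul_sum]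
  rw [pd_mul a (differentiableAt_of_smooth hg.isOpen hy hf)
    (differentiableAt_of_smooth hg.isOpen hy (hg.smooth b c))]
  linear_combination f y * h1

/-- The Leibniz rule for `A_b{}^{μν} T_{μν}`. -/
theorem IsMetricOn.nabla1_contract2 (hg : IsMetricOn g U) (hy : y ∈ U) {T : Comp2 n}
    (hA : ∀ a b c, ContDiffOn ℝ ∞ (A a b c) U) (hT : ∀ a b, ContDiffOn ℝ ∞ (T a b) U)
    (a b : Fin n) :
    nabla1 g (contract2 g A T) a b y
      = tr g y (fun μ ρ => tr g y fun ν τ => nabla3 g A a b μ ν y * T ρ τ y)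
        + tr g y fun μ ρ => tr g y fun ν τ => A b μ ν y * nabla2 g T a ρ τ y := by
  have hAT : ∀ μ ρ ν τ, ContDiffOn ℝ ∞ (fun z => A b μ ν z * T ρ τ z) U := fun μ ρ ν τ =>
    (hA b μ ν).mul (hT ρ τ)
  have h1 : pd a (contract2 g A T b) y = tr g y fun μ ρ =>
      nabla2 g (fun μ ρ z => tr g z fun ν τ => A b μ ν z * T ρ τ z) a μ ρ y :=
    hg.pd_tr hy (T := fun μ ρ z => tr g z fun ν τ => A b μ ν z * T ρ τ z)
      (fun μ ρ => hg.smooth_tr (T := fun ν τ z => A b μ ν z * T ρ τ z) (hAT μ ρ)) a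
  have h2 : ∀ μ ρ, pd a (fun z => tr g z fun ν τ => A b μ ν z * T ρ τ z) y
      = tr g y fun ν τ => nabla2 g (fun ν τ z => A b μ ν z * T ρ τ z) a ν τ y := fun μ ρ =>
    hg.pd_tr hy (T := fun ν τ z => A b μ ν z * T ρ τ z) (hAT μ ρ) a
  have h3 : ∀ μ ρ ν τ, pd a (fun z => A b μ ν z * T ρ τ z) y
      = pd a (A b μ ν) y * T ρ τ y + A b μ ν y * pd a (T ρ τ) y := fun μ ρ ν τ =>
    pd_mul a (differentiableAt_of_smooth hg.isOpen hy (hA b μ ν))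
      (differentiableAt_of_smooth hg.isOpen hy (hT ρ τ))
  rw [nabla1, h1, ← tr_add]
  simp only [contract2, ← tr_mul_left, ← tr_sum, ← tr_sub, ← tr_add]
  congr 1; ext μ ρ
  rw [nabla2, h2]
  simp only [← tr_mul_left, ← tr_sum, ← tr_sub]
  congr 1; ext ν τ
  simp only [nabla2, nabla3, h3, sub_mul, mul_sub, Finset.sum_mul, Finset.mul_sum, mul_assoc,
    mul_left_comm (A b μ ν y)]
  ring

end Nabla

namespace IsPatch

theorem smooth_halfSum (h : IsPatch g P E G F A U) (a b : Fin n) :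
    ContDiffOn ℝ ∞ (halfSum E G a b) U :=
  ((h.smoothE a b).add (h.smoothG a b)).div_const 2

theorem nabla2_halfSum (h : IsPatch g P E G F A U) (hy : y ∈ U) (a b c : Fin n) :
    nabla2 g (halfSum E G) a b c y = (nabla2 g E a b c y + nabla2 g G a b c y) / 2 := by
  have hE := differentiableAt_of_smooth h.metric.isOpen hy (h.smoothE b c)
  have hG := differentiableAt_of_smooth h.metric.isOpen hy (h.smoothG b c)
  have e : halfSum E G = fun a b y => (1 / 2) * (E a b y + G a b y) := by
    ext a b y; simp only [halfSum]; ring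
  rw [e, nabla2_const_mul (T := fun a b y => E a b y + G a b y) _ _ _ _ (hE.add hG),
    nabla2_add a b c hE hG]
  ring

theorem nabla2_halfDiff (h : IsPatch g P E G F A U) (hy : y ∈ U) (a b c : Fin n) :
    nabla2 g (halfDiff E G) a b c y = (nabla2 g E a b c y - nabla2 g G a b c y) / 2 := by
  have hE := differentiableAt_of_smooth h.metric.isOpen hy (h.smoothE b c)
  have hG := differentiableAt_of_smooth h.metric.isOpen hy (h.smoothG b c)
  have e : halfDiff E G = fun a b y => (1 / 2) * (E a b y - G a b y) := by
    ext a b y; simp only [halfDiff]; ring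
  rw [e, nabla2_const_mul (T := fun a b y => E a b y - G a b y) _ _ _ _ (hE.sub hG),
    nabla2_sub a b c hE hG]
  ring

theorem tr_mul_swap (h : IsPatch g P E G F A U) (S T : Fin n → ℝ) :
    tr g y (fun m j => S m * T j) = tr g y fun m j => T m * S j := by
  rw [← h.metric.tr_swap]
  simp only [mul_comm]

theorem tr_mul_sub (S T T' : Fin n → ℝ) : tr g y (fun m j => S m * (T j - T' j))
    = tr g y (fun m j => S m * T j) - tr g y fun m j => S m * T' j := by
  simp only [mul_sub, tr_sub]

theorem tr_mul_add (S T T' : Fin n → ℝ) : tr g y (fun m j => S m * (T j + T' j))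
    = tr g y (fun m j => S m * T j) + tr g y fun m j => S m * T' j := by
  simp only [mul_add, tr_add]

theorem tr_mul_div (S T : Fin n → ℝ) (r : ℝ) : tr g y (fun m j => S m * (T j / r))
    = tr g y (fun m j => S m * T j) / r := by
  simp only [div_eq_mul_inv, ← mul_assoc, tr_mul_right]

/-- The substitution `P - E = X - N`, `P + G = X + N` separates the pair: `F` occurs only in the
mean, while the skew derivatives of `P` and `V` occur only in the deviation. -/
theorem curvVec_curvForm_eq (h : IsPatch g P E G F A U) (hy : y ∈ U) (a b c : Fin n) :
    curvVec g (fun a b y => P a b y - E a b y) F A a b c y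
        = curvDev g P (halfSum E G) (halfDiff E G) A a b c y
          + curvMean g (halfSum E G) (fun a b y => P a b y - halfDiff E G a b y) F A a b c y ∧
    curvForm g (fun a b y => P a b y + G a b y) F A a b c y
        = curvMean g (halfSum E G) (fun a b y => P a b y - halfDiff E G a b y) F A a b c y
          - curvDev g P (halfSum E G) (halfDiff E G) A a b c y := by
  have hd : ∀ b c, DifferentiableAt ℝ (P b c) y ∧ DifferentiableAt ℝ (E b c) y
      ∧ DifferentiableAt ℝ (G b c) y := fun b c =>
    ⟨differentiableAt_of_smooth h.metric.isOpen hy (h.smoothP b c),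
      differentiableAt_of_smooth h.metric.isOpen hy (h.smoothE b c),
      differentiableAt_of_smooth h.metric.isOpen hy (h.smoothG b c)⟩
  have hQ : ∀ a b c, nabla2 g (fun a b y => P a b y - E a b y) a b c y
      = nabla2 g P a b c y - nabla2 g E a b c y := fun a b c =>
    nabla2_sub a b c (hd b c).1 (hd b c).2.1
  have hS : ∀ a b c, nabla2 g (fun a b y => P a b y + G a b y) a b c y
      = nabla2 g P a b c y + nabla2 g G a b c y := fun a b c =>
    nabla2_add a b c (hd b c).1 (hd b c).2.2
  have hA : ∀ p m, A p m c y = A p c m y := fun p m => h.symmA' p m c y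
  simp only [curvVec, curvForm, curvMean, curvDev, hQ, hS, h.nabla2_halfSum hy,
    h.nabla2_halfDiff hy]
  simp only [h.tr_mul_swap _ (fun j => A _ _ j y), hA]
  simp only [halfSum, halfDiff, tr_mul_sub, tr_mul_add, tr_mul_div, h.metric.symm c _ y]
  constructor <;> ring

theorem curv_pair_eq_zero_iff (h : IsPatch g P E G F A U) (hy : y ∈ U) (a b c : Fin n) :
    (curvVec g (fun a b y => P a b y - E a b y) F A a b c y = 0 ∧
      curvForm g (fun a b y => P a b y + G a b y) F A a b c y = 0) ↔
    curvMean g (halfSum E G) (fun a b y => P a b y - halfDiff E G a b y) F A a b c y = 0 ∧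
      curvDev g P (halfSum E G) (halfDiff E G) A a b c y = 0 := by
  obtain ⟨h1, h2⟩ := h.curvVec_curvForm_eq hy a b c
  rw [h1, h2]
  constructor
  · rintro ⟨h3, h4⟩; constructor <;> linarith
  · rintro ⟨h3, h4⟩; constructor <;> linarith

theorem tr_tr_mul_eq_zero (h : IsPatch g P E G F A U) (hy : y ∈ U) (T : Fin n → ℝ) :
    tr g y (fun b c => tr g y fun m j => A b c m y * T j) = 0 := by
  rw [tr_comm]
  simp only [tr_mul_right, h.trA y hy, zero_mul, tr_zero]

theorem tr_tr_mul_eq_contract2 (h : IsPatch g P E G F A U) (T : Comp2 n) (a : Fin n) :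
    tr g y (fun b c => tr g y fun m j => A a c m y * T b j y) = contract2 g A T a y :=
  h.metric.tr_swap (fun c b => tr g y fun m j => A a c m y * T b j y)

theorem tr_nabla2_halfSum (h : IsPatch g P E G F A U) (hy : y ∈ U) (a : Fin n) :
    tr g y (fun b c => nabla2 g (halfSum E G) a b c y) = 0 := by
  rw [← h.metric.pd_tr hy h.smooth_halfSum,
    pd_congr a h.metric.isOpen hy (g := fun _ => 0) fun z hz => h.tr_halfSum hz, pd_const]

/-- The formula for `N` is needed on all of `U`, since its divergence produces `δ²A`; `tr N = 0` and
`tr A = 0` remove the other terms. -/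
theorem tr_curvMean (h : IsPatch g P E G F A U) (hy : y ∈ U)
    (hN : ∀ z ∈ U, ∀ a b, halfSum E G a b z = -(1 / (n : ℝ)) * div1 g A a b z)
    (hV : ∀ a b, halfDiff E G a b y = PA g A a b y) (a : Fin n) :
    tr g y (fun b c => curvMean g (halfSum E G) (fun a b y => P a b y - halfDiff E G a b y) F A
      a b c y) = ((n : ℝ) - 1) * F a y - 1 / n * div2 g A a y
        - contract2 g A (fun μ ν y => P μ ν y - PA g A μ ν y) a y := by
  have hn0 := h.cast_facts.1
  have hdiv : tr g y (fun b c => nabla2 g (halfSum E G) b a c y) = -(1 / n) * div2 g A a y := by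
    have h1 : ∀ b c, nabla2 g (div1 g A) b a c y = -n * nabla2 g (halfSum E G) b a c y := by
      intro b c
      rw [← nabla2_const_mul _ _ _ _
        (differentiableAt_of_smooth h.metric.isOpen hy (h.smooth_halfSum a c))]
      refine nabla2_congr h.metric.isOpen hy (fun z hz b c => ?_) _ _ _
      rw [hN z hz]; field_simp
    simp only [div2, h1]
    rw [tr_mul_left]; field_simp
  have e1 := h.metric.tr_metric_mul' hy a fun b => F b y
  have e2 : tr g y (fun b c => F b y * g a c y) = F a y := by simpa only [mul_comm] using e1
  have e3 := h.tr_tr_mul_eq_contract2 (y := y) (fun a b y => P a b y - halfDiff E G a b y) a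
  have e4 : contract2 g A (fun a b y => P a b y - halfDiff E G a b y) a y
      = contract2 g A (fun μ ν y => P μ ν y - PA g A μ ν y) a y := by
    simp only [contract2, hV]
  simp only [curvMean]
  rw [tr_add, tr_sub, tr_sub, tr_sub, tr_sub, tr_mul_left, h.metric.tr_metric hy, e2,
    h.tr_nabla2_halfSum hy, hdiv, h.tr_tr_mul_eq_zero hy, e3, e4]
  ring

theorem tr_curvMean_eq_zero_iff (h : IsPatch g P E G F A U) (hy : y ∈ U)
    (hN : ∀ z ∈ U, ∀ a b, halfSum E G a b z = -(1 / (n : ℝ)) * div1 g A a b z)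
    (hV : ∀ a b, halfDiff E G a b y = PA g A a b y) (a : Fin n) :
    tr g y (fun b c => curvMean g (halfSum E G) (fun a b y => P a b y - halfDiff E G a b y) F A
      a b c y) = 0 ↔ F a y = 1 / ((n : ℝ) * ((n : ℝ) - 1)) * div2 g A a y
        + 1 / ((n : ℝ) - 1) * contract2 g A (fun μ ν y => P μ ν y - PA g A μ ν y) a y := by
  obtain ⟨hn0, hn1⟩ := h.cast_facts
  rw [h.tr_curvMean hy hN hV]
  constructor
  · intro h1
    field_simp
    field_simp at h1
    linarith
  · intro h1
    rw [h1]
    field_simp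
    ring

theorem curvDev_eq_of_three (h : IsPatch g P E G F A U) (hn : n = 3) (hy : y ∈ U)
    (hN : ∀ a b, halfSum E G a b y = -(1 / (n : ℝ)) * div1 g A a b y)
    (hV : ∀ z ∈ U, ∀ a b, halfDiff E G a b z = PA g A a b z) (a b c : Fin n) :
    curvDev g P (halfSum E G) (halfDiff E G) A a b c y
      = -2 * (skew (fun a b => nabla2 g (PA g A) a b c y) a b
      + (1 / 3) * skew (fun a b => tr g y fun μ ν => A μ c a y * div1 g A b ν y) a b
      - cotton g P a b c y) := by
  have hn' : (n : ℝ) = 3 := by exact_mod_cast hn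
  have hA : ∀ p m, A m c p y = A p c m y := fun p m => by
    rw [h.symmA' m c p, h.symmA m p c, h.symmA' p m c]
  simp only [curvDev, hN, skew, cotton, nabla2_congr h.metric.isOpen hy hV, hA, hn',
    mul_left_comm (A _ _ _ _), tr_mul_left]
  ring

theorem smooth_normSq (h : IsPatch g P E G F A U) : ContDiffOn ℝ ∞ (normSq g A) U :=
  h.metric.smooth_tr (T := sqTensor g A) fun a b =>
    h.metric.smooth_tr (T := fun μ ρ z => tr g z fun ν τ => A a μ ν z * A b ρ τ z) fun μ ρ =>
      h.metric.smooth_tr (T := fun ν τ z => A a μ ν z * A b ρ τ z) fun ν τ =>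
        (h.smoothA a μ ν).mul (h.smoothA b ρ τ)

theorem tr_curvDev_of_two (h : IsPatch g P E G F A U) (hn : n = 2) (hy : y ∈ U)
    (hN : ∀ a b, halfSum E G a b y = -(1 / (n : ℝ)) * div1 g A a b y)
    (hV : ∀ z ∈ U, ∀ a b, halfDiff E G a b z = PA g A a b z) (a : Fin n) :
    tr g y (fun b c => curvDev g P (halfSum E G) (halfDiff E G) A a b c y)
      = -(1 / 4) * (pd a (normSq g A) y + 2 * contract2 g A (div1 g A) a y
      - 8 * (tr g y fun μ ν => cotton g P a μ ν y)) := by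
  have hn' : (n : ℝ) = 2 := by exact_mod_cast hn
  have hf : ContDiffOn ℝ ∞ (fun z => (1 / 4) * normSq g A z) U :=
    contDiffOn_const.mul h.smooth_normSq
  -- In dimension two `V = |A|² g / 4` and `g` is parallel, so only the differential of `|A|²`
  -- remains.
  have hV' : ∀ a b c, nabla2 g (halfDiff E G) a b c y = (1 / 4) * pd a (normSq g A) y * g b c y := by
    intro a b c
    rw [← pd_const_mul a _ (differentiableAt_of_smooth h.metric.isOpen hy h.smooth_normSq),
      ← h.metric.nabla2_mul_metric hy hf]
    exact nabla2_congr h.metric.isOpen hy (fun z hz b c => by rw [hV z hz, PA, if_pos hn]) a b c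
  have e1 : tr g y (fun b c => nabla2 g P a b c y - nabla2 g P b a c y)
      = 2 * tr g y fun μ ν => cotton g P a μ ν y := by
    rw [← tr_mul_left]
    congr 1; ext b c
    simp only [cotton, skew]; ring
  have e2 : tr g y (fun b c => pd b (normSq g A) y * g a c y) = pd a (normSq g A) y := by
    have := h.metric.tr_metric_mul' hy a fun b => pd b (normSq g A) y
    simpa only [mul_comm] using this
  have e3 := h.tr_tr_mul_eq_contract2 (y := y) (div1 g A) a
  simp only [curvDev, hV', hN, mul_left_comm (A _ _ _ _), tr_mul_left, tr_add, tr_sub, e1,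
    mul_assoc, e2, e3, h.tr_tr_mul_eq_zero hy, h.metric.tr_metric hy, hn']
  ring

theorem contract2_metric (h : IsPatch g P E G F A U) (hy : y ∈ U) (f : Coord n → ℝ) (a : Fin n) :
    contract2 g A (fun μ ν y => f y * g μ ν y) a y = 0 := by
  have h1 : ∀ μ ρ, tr g y (fun ν τ => A a μ ν y * g ρ τ y) = A a μ ρ y := fun μ ρ => by
    have := h.metric.tr_metric_mul' hy ρ fun ν => A a μ ν y
    simpa only [mul_comm] using this
  have h2 : ∀ μ ρ, A a μ ρ y = A μ ρ a y := fun μ ρ => by rw [h.symmA, h.symmA']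
  simp only [contract2, mul_left_comm (A _ _ _ _), tr_mul_left, h1]
  simp only [h2, h.trA y hy, mul_zero]

end IsPatch
end ConformalCodazzi

/-! ### The Codazzi equation in dimension two, and the theorem in a patch -/

namespace ConformalCodazzi

variable {n : ℕ} {U : Set (Coord n)} {y : Coord n} {g P E G : Comp2 n} {F : Comp1 n} {A : Comp3 n}

namespace IsPatch

theorem eq_halfSum_add (a b : Fin n) : E a b y = halfSum E G a b y + halfDiff E G a b y := by
  simp only [halfSum, halfDiff]; ring

theorem eq_halfSum_sub (a b : Fin n) : G a b y = halfSum E G a b y - halfDiff E G a b y := by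
  simp only [halfSum, halfDiff]; ring

theorem halfSum_symm (h : IsPatch g P E G F A U) (a b : Fin n) (y : Coord n) :
    halfSum E G a b y = halfSum E G b a y := by
  simp only [halfSum, h.symmE a b, h.symmG a b]

theorem smooth_contract2 (h : IsPatch g P E G F A U) (a : Fin n) :
    ContDiffOn ℝ ∞ (contract2 g A P a) U :=
  h.metric.smooth_tr (T := fun μ ρ z => tr g z fun ν τ => A a μ ν z * P ρ τ z) fun μ ρ =>
    h.metric.smooth_tr (T := fun ν τ z => A a μ ν z * P ρ τ z) fun ν τ =>
      (h.smoothA a μ ν).mul (h.smoothP ρ τ)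

/-- Here `V = f g` commutes with everything, and the squares of `P` and `N` are symmetric, so
skewing `(P + N - f g)(P - N - f g)` leaves twice the commutator of `N` and `P`. -/
theorem commutator_term_of_two (h : IsPatch g P E G F A U) (hn : n = 2) (hy : y ∈ U)
    (hV : ∀ a b, halfDiff E G a b y = PA g A a b y) (a b : Fin n) :
    tr g y (fun m j => (P a m y + G a m y) * (P b j y - E b j y))
      - tr g y (fun m j => (P b m y + G b m y) * (P a j y - E a j y))
      = 2 * (tr g y (fun m j => halfSum E G a m y * P b j y)
        - tr g y fun m j => P a m y * halfSum E G b j y) := by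
  set f := (1 / 4) * normSq g A y
  have hV' : ∀ a b, halfDiff E G a b y = f * g a b y := fun a b => by rw [hV, PA, if_pos hn]
  have hg1 : ∀ (T : Fin n → ℝ) p, tr g y (fun m j => g p m y * T j) = T p := fun T p =>
    h.metric.tr_metric_mul hy p T
  have hg2 : ∀ (T : Fin n → ℝ) p, tr g y (fun m j => T m * g p j y) = T p := fun T p =>
    (h.tr_mul_swap _ _).trans (hg1 T p)
  have key : ∀ a b, tr g y (fun m j => (P a m y + G a m y) * (P b j y - E b j y))
      = tr g y (fun m j => P a m y * P b j y) - tr g y (fun m j => P a m y * halfSum E G b j y)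
        - f * P a b y + tr g y (fun m j => halfSum E G a m y * P b j y)
        - tr g y (fun m j => halfSum E G a m y * halfSum E G b j y) - f * halfSum E G a b y
        - f * P b a y + f * halfSum E G b a y + f * f * g b a y := by
    intro a b
    have e : ∀ m j, (P a m y + G a m y) * (P b j y - E b j y)
        = P a m y * P b j y - P a m y * halfSum E G b j y - f * (P a m y * g b j y)
          + halfSum E G a m y * P b j y - halfSum E G a m y * halfSum E G b j y
          - f * (halfSum E G a m y * g b j y) - f * (g a m y * P b j y)
          + f * (g a m y * halfSum E G b j y) + f * f * (g a m y * g b j y) := by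
      intro m j
      rw [eq_halfSum_sub (E := E) (G := G) a m, eq_halfSum_add (E := E) (G := G) b j, hV', hV']
      ring
    simp only [e]
    simp only [tr_add, tr_sub, tr_mul_left, hg1, hg2]
  rw [key, key, h.symmP y hy b a, h.halfSum_symm b a, h.metric.symm b a,
    h.tr_mul_swap (fun m => P b m y) fun j => P a j y,
    h.tr_mul_swap (fun m => halfSum E G b m y) fun j => halfSum E G a j y,
    h.tr_mul_swap (fun m => P b m y) fun j => halfSum E G a j y,
    h.tr_mul_swap (fun m => halfSum E G b m y) fun j => P a j y]
  ring

/-- The formula for `F` reduces to `F = δ²A / 2 + A·P`, since `P^A` is pure trace and `A` is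
trace-free. In its skew derivative, `A·∇P` stays, whereas the term with `∇A` becomes a commutator of
`N` and `P` that combines with the one from `commutator_term_of_two`. -/
theorem curvScal_eq_of_two (h : IsPatch g P E G F A U) (hn : n = 2) (hy : y ∈ U)
    (hN : ∀ z ∈ U, ∀ a b, halfSum E G a b z = -(1 / (n : ℝ)) * div1 g A a b z)
    (hV : ∀ z ∈ U, ∀ a b, halfDiff E G a b z = PA g A a b z)
    (hF : ∀ z ∈ U, ∀ a, F a z = 1 / ((n : ℝ) * ((n : ℝ) - 1)) * div2 g A a z
      + 1 / ((n : ℝ) - 1) * contract2 g A (fun μ ν y => P μ ν y - PA g A μ ν y) a z)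
    (hC : ∀ a b c d, codazziTensor g (halfSum E G) A a b c d y = 0) (a b : Fin n) :
    curvScal g (fun a b y => P a b y - E a b y) (fun a b y => P a b y + G a b y) F a b y
      = -(skew (fun a b => nabla1 g (div2 g A) a b y) a b
      + 4 * skew (fun a b => tr g y fun μ ν => P μ a y * div1 g A b ν y) a b
      - 2 * skew (fun a b => contract2 g (fun a μ ν y => A μ ν a y)
          (fun μ ν y => nabla2 g P b μ ν y) a y) a b) := by
  have hn' : (n : ℝ) = 2 := by exact_mod_cast hn
  have hU := h.metric.isOpen
  have hcP : ∀ z ∈ U, ∀ a, contract2 g A (fun μ ν y => P μ ν y - PA g A μ ν y) a z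
      = contract2 g A P a z := by
    intro z hz a
    have h1 := h.contract2_metric hz (fun y => (1 / 4) * normSq g A y) a
    have h2 : contract2 g A (fun μ ν y => P μ ν y - PA g A μ ν y) a z
        = contract2 g A P a z
          - contract2 g A (fun μ ν y => (1 / 4) * normSq g A y * g μ ν y) a z := by
      simp only [contract2, PA, if_pos hn, mul_sub, tr_sub]
    rw [h2, h1, sub_zero]
  have hdiv : ∀ z ∈ U, ∀ a, div2 g A a z = 2 * F a z - 2 * contract2 g A P a z := by
    intro z hz a
    rw [hF z hz a, hcP z hz, hn']; ring
  have hFd : ∀ a, DifferentiableAt ℝ (F a) y := fun a =>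
    differentiableAt_of_smooth hU hy (h.smoothF a)
  have hcd : ∀ a, DifferentiableAt ℝ (contract2 g A P a) y := fun a =>
    differentiableAt_of_smooth hU hy (h.smooth_contract2 a)
  have hnd : ∀ a b, nabla1 g (div2 g A) a b y
      = 2 * nabla1 g F a b y - 2 * nabla1 g (contract2 g A P) a b y := by
    intro a b
    simp only [nabla1]
    rw [pd_congr a hU hy fun z hz => hdiv z hz b,
      pd_sub a ((hFd b).const_mul 2) ((hcd b).const_mul 2), pd_const_mul a 2 (hFd b),
      pd_const_mul a 2 (hcd b)]
    simp only [hdiv y hy, mul_sub, Finset.sum_sub_distrib, mul_left_comm _ (2 : ℝ),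
      ← Finset.mul_sum]
    ring
  have hL := h.metric.nabla1_contract2 hy h.smoothA h.smoothP
  have hg1 : ∀ (T : Fin n → ℝ) p, tr g y (fun m j => g p m y * T j) = T p := fun T p =>
    h.metric.tr_metric_mul hy p T
  -- The vanishing Codazzi tensor expresses the skew part of `∇A` through `g` and `N`; contraction
  -- with the symmetric `P` leaves `N·P` terms.
  have hcodazzi : tr g y (fun μ ρ => tr g y fun ν τ => nabla3 g A a b μ ν y * P ρ τ y)
      - tr g y (fun μ ρ => tr g y fun ν τ => nabla3 g A b a μ ν y * P ρ τ y)
      = 2 * (tr g y (fun m j => halfSum E G a m y * P b j y)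
        - tr g y fun m j => halfSum E G b m y * P a j y) := by
    have e : ∀ μ ν ρ τ, nabla3 g A a b μ ν y * P ρ τ y - nabla3 g A b a μ ν y * P ρ τ y
        = halfSum E G a μ y * (g b ν y * P ρ τ y) - halfSum E G b μ y * (g a ν y * P ρ τ y)
          - g a μ y * (halfSum E G b ν y * P ρ τ y) + g b μ y * (halfSum E G a ν y * P ρ τ y) := by
      intro μ ν ρ τ
      have := hC a b μ ν
      simp only [codazziTensor] at this
      rw [h.metric.symm a μ, h.metric.symm b μ]
      linear_combination -P ρ τ y * this
    simp only [← tr_sub, e]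
    simp only [tr_add, tr_sub, tr_mul_left, hg1]
    simp only [h.symmP y hy _ a, h.symmP y hy _ b]
    ring
  have hA : ∀ p μ ν, A μ ν p y = A p μ ν y := fun p μ ν => by rw [h.symmA', h.symmA]
  have hT := h.commutator_term_of_two hn hy (hV y hy) a b
  have hsw : ∀ p q, tr g y (fun m j => halfSum E G p m y * P q j y)
      = -(1 / 2) * tr g y fun μ ν => P μ q y * div1 g A p ν y := by
    intro p q
    rw [h.tr_mul_swap]
    simp only [hN y hy, h.symmP y hy _ q, mul_left_comm (P _ _ y), tr_mul_left, hn']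
  rw [h.tr_mul_swap (fun m => P a m y), hsw, hsw] at hT
  rw [hsw, hsw] at hcodazzi
  simp only [curvScal, skew, hnd, hL, contract2, hA]
  linear_combination -hT - hcodazzi

theorem gaussTensor_eq_zero_iff (h : IsPatch g P E G F A U) (hy : y ∈ U) :
    (∀ a b c d, gaussTensor g P E G A a b c d y = 0) ↔
      (∀ a b, halfDiff E G a b y = PA g A a b y) ∧
      (4 ≤ n → ∀ a b c d, tfCurv g (cubicCurv g A) a b c d y + weyl g P a b c d y = 0) := by
  rcases Nat.lt_or_ge 2 n with hn | hn
  · exact h.gaussTensor_eq_zero_iff_of_three_le hy hn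
  · rw [h.gaussTensor_eq_zero_iff_of_two hy (le_antisymm hn h.two_le)]
    exact ⟨fun h1 => ⟨h1, fun h4 => absurd h4 (by omega)⟩, And.left⟩

theorem curvMean_skew (g N X : Comp2 n) (F : Comp1 n) (A : Comp3 n) (a b c : Fin n)
    (y : Coord n) : curvMean g N X F A a b c y = -curvMean g N X F A b a c y := by
  simp only [curvMean]; ring

theorem curvDev_skew (g P N V : Comp2 n) (A : Comp3 n) (a b c : Fin n) (y : Coord n) :
    curvDev g P N V A a b c y = -curvDev g P N V A b a c y := by
  simp only [curvDev]; ring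

theorem flatOn_iff_curv (h : IsPatch g P E G F A U) : FlatOn g P E G F A U ↔
    ∀ y ∈ U, (∀ a b c d, gaussTensor g P E G A a b c d y = 0) ∧
      (∀ a b c d, codazziTensor g (halfSum E G) A a b c d y = 0) ∧
      (∀ a b c, curvMean g (halfSum E G) (fun a b y => P a b y - halfDiff E G a b y) F A
        a b c y = 0) ∧
      (∀ a b c, curvDev g P (halfSum E G) (halfDiff E G) A a b c y = 0) ∧
      ∀ a b, curvScal g (fun a b y => P a b y - E a b y) (fun a b y => P a b y + G a b y) F
        a b y = 0 := by
  rw [flatOn_iff_curvMat h.metric.isOpen h.isConnOn.smoothMat_connMat]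
  refine forall₂_congr fun y hy => ?_
  simp only [h.isConnOn.curvMat_eq_zero_iff hy]
  constructor
  · intro h0
    obtain ⟨h1, h2⟩ := (h.curvEnd_eq_zero_iff hy).1 fun a b => (h0 a b).2.1
    have h3 := fun a b c => (h.curv_pair_eq_zero_iff hy a b c).1 ⟨(h0 a b).1 c, (h0 a b).2.2.1 c⟩
    exact ⟨h1, h2, fun a b c => (h3 a b c).1, fun a b c => (h3 a b c).2, fun a b => (h0 a b).2.2.2⟩
  · rintro ⟨h1, h2, h3, h4, h5⟩ a b
    have h6 := fun c => (h.curv_pair_eq_zero_iff hy a b c).2 ⟨h3 a b c, h4 a b c⟩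
    exact ⟨fun c => (h6 c).1, (h.curvEnd_eq_zero_iff hy).2 ⟨h1, h2⟩ a b, fun c => (h6 c).2, h5 a b⟩

/-- The Bianchi identity reduces flatness to the `μ → μ` entry and the trace of `curvMean`; only for
`n = 3` must `curvDev` be prescribed as well. -/
theorem flatOn_of_three_le (h : IsPatch g P E G F A U) (hn : 3 ≤ n)
    (h1 : ∀ y ∈ U, ∀ a b c d, gaussTensor g P E G A a b c d y = 0)
    (h2 : ∀ y ∈ U, ∀ a b c d, codazziTensor g (halfSum E G) A a b c d y = 0)
    (ht : ∀ y ∈ U, ∀ a, tr g y (fun b c => curvMean g (halfSum E G)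
      (fun a b y => P a b y - halfDiff E G a b y) F A a b c y) = 0)
    (h3 : n = 3 → ∀ y ∈ U, ∀ a b c,
      curvDev g P (halfSum E G) (halfDiff E G) A a b c y = 0) :
    FlatOn g P E G F A U := by
  have hE : ∀ y ∈ U, ∀ a b c d, curvEnd g (fun a b y => P a b y - E a b y)
      (fun a b y => P a b y + G a b y) A a b c d y = 0 := fun y hy =>
    (h.curvEnd_eq_zero_iff hy).2 ⟨h1 y hy, h2 y hy⟩
  have hsum : ∀ y ∈ U, ∀ a b c, curvVec g (fun a b y => P a b y - E a b y) F A a b c y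
      + curvForm g (fun a b y => P a b y + G a b y) F A a b c y = 0 := fun y hy =>
    h.isConnOn.curvVec_add_curvForm_eq_zero h.two_le hy hE fun a => by
      have : ∀ b c, curvVec g (fun a b y => P a b y - E a b y) F A a b c y
          + curvForm g (fun a b y => P a b y + G a b y) F A a b c y
          = 2 * curvMean g (halfSum E G) (fun a b y => P a b y - halfDiff E G a b y) F A
            a b c y := fun b c => by
        rw [(h.curvVec_curvForm_eq hy a b c).1, (h.curvVec_curvForm_eq hy a b c).2]; ring
      simp only [this, tr_mul_left, ht y hy, mul_zero]
  have hV : ∀ y ∈ U, ∀ a b c, curvVec g (fun a b y => P a b y - E a b y) F A a b c y = 0 := by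
    intro y hy a b c
    rcases Nat.lt_or_ge 3 n with hn4 | hn3
    · exact h.isConnOn.curvVec_eq_zero hn4 hy hE (hsum y hy) a b c
    · have e1 := hsum y hy a b c
      obtain ⟨e2, e3⟩ := h.curvVec_curvForm_eq hy a b c
      rw [h3 (le_antisymm hn3 hn) y hy] at e2 e3
      linarith
  rw [flatOn_iff_curvMat h.metric.isOpen h.isConnOn.smoothMat_connMat]
  intro y hy a b
  refine (h.isConnOn.curvMat_eq_zero_iff hy a b).2 ⟨hV y hy a b, hE y hy a b, fun c => ?_,
    h.isConnOn.curvScal_eq_zero hn hy hE hV a b⟩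
  have e1 := hsum y hy a b c
  rwa [hV y hy, zero_add] at e1

/-- The theorem in a coordinate patch. -/
theorem flatOn_iff (h : IsPatch g P E G F A U) : FlatOn g P E G F A U ↔
    FormulasOn g P E G F A U ∧
      ((4 ≤ n → Gauss4On g P A U) ∧ (n = 3 → Gauss3On g P A U) ∧ (n = 2 → Gauss2On g P A U)) ∧
      ((3 ≤ n → Codazzi3On g A U) ∧ (n = 2 → Codazzi2On g P A U)) := by
  constructor
  · intro hflat
    have hc := h.flatOn_iff_curv.1 hflat
    have hV := fun y hy => ((h.gaussTensor_eq_zero_iff hy).1 (hc y hy).1)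
    have hN := fun y hy => ((h.codazziTensor_eq_zero_iff hy).1 (hc y hy).2.1)
    have hV' := fun y hy => (hV y hy).1
    have hN' := fun y hy => (hN y hy).1
    have hF : ∀ y ∈ U, ∀ a, F a y = 1 / ((n : ℝ) * ((n : ℝ) - 1)) * div2 g A a y
        + 1 / ((n : ℝ) - 1) * contract2 g A (fun μ ν y => P μ ν y - PA g A μ ν y) a y :=
      fun y hy a => (h.tr_curvMean_eq_zero_iff hy hN' (hV' y hy) a).1 (by
        simp only [(hc y hy).2.2.1, tr_zero])
    refine ⟨fun y hy => ⟨fun a b => ?_, fun a b => ?_, hF y hy⟩, ⟨fun hn y hy => (hV y hy).2 hn,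
      fun hn y hy a b c => ?_, fun hn y hy a => ?_⟩, fun hn y hy => (hN y hy).2 hn,
      fun hn y hy a b => ?_⟩
    · rw [eq_halfSum_add (E := E) (G := G), hN' y hy, hV' y hy]
    · rw [eq_halfSum_sub (E := E) (G := G), hN' y hy, hV' y hy]
    · have e := h.curvDev_eq_of_three hn hy (hN' y hy) hV' a b c
      rw [(hc y hy).2.2.2.1] at e
      linarith
    · have e := h.tr_curvDev_of_two hn hy (hN' y hy) hV' a
      simp only [(hc y hy).2.2.2.1, tr_zero] at e
      linarith
    · have e := h.curvScal_eq_of_two hn hy hN' hV' hF (hc y hy).2.1 a b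
      rw [(hc y hy).2.2.2.2] at e
      linarith
  · rintro ⟨hform, ⟨hG4, hG3, hG2⟩, hC3, hC2⟩
    have hV : ∀ y ∈ U, ∀ a b, halfDiff E G a b y = PA g A a b y := fun y hy a b => by
      rw [halfDiff, (hform y hy).1, (hform y hy).2.1]; ring
    have hN : ∀ y ∈ U, ∀ a b, halfSum E G a b y = -(1 / (n : ℝ)) * div1 g A a b y :=
      fun y hy a b => by rw [halfSum, (hform y hy).1, (hform y hy).2.1]; ring
    have hF := fun y hy => (hform y hy).2.2
    have h1 : ∀ y ∈ U, ∀ a b c d, gaussTensor g P E G A a b c d y = 0 := fun y hy =>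
      (h.gaussTensor_eq_zero_iff hy).2 ⟨hV y hy, fun hn => hG4 hn y hy⟩
    have h2 : ∀ y ∈ U, ∀ a b c d, codazziTensor g (halfSum E G) A a b c d y = 0 := fun y hy =>
      (h.codazziTensor_eq_zero_iff hy).2 ⟨hN y hy, fun hn => hC3 hn y hy⟩
    have ht : ∀ y ∈ U, ∀ a, tr g y (fun b c => curvMean g (halfSum E G)
        (fun a b y => P a b y - halfDiff E G a b y) F A a b c y) = 0 := fun y hy a =>
      (h.tr_curvMean_eq_zero_iff hy hN (hV y hy) a).2 (hF y hy a)
    rcases Nat.lt_or_ge 2 n with hn | hn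
    · refine h.flatOn_of_three_le hn h1 h2 ht fun hn3 y hy a b c => ?_
      rw [h.curvDev_eq_of_three hn3 hy (hN y hy) hV, hG3 hn3 y hy a b c, mul_zero]
    · have hn2 : n = 2 := le_antisymm hn h.two_le
      -- In dimension two the Bianchi identity is not used: the mixed components follow from their
      -- traces, and `σ → φ` is an independent condition.
      refine h.flatOn_iff_curv.2 fun y hy => ⟨h1 y hy, h2 y hy, ?_, ?_, fun a b => ?_⟩
      · exact h.metric.eq_zero_of_tr_of_two hy hn2 (fun a b c => curvMean g (halfSum E G)
          (fun a b y => P a b y - halfDiff E G a b y) F A a b c y)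
          (fun a b c => curvMean_skew _ _ _ _ _ a b c y) (ht y hy)
      · refine h.metric.eq_zero_of_tr_of_two hy hn2
          (fun a b c => curvDev g P (halfSum E G) (halfDiff E G) A a b c y)
          (fun a b c => curvDev_skew _ _ _ _ _ a b c y) fun a => ?_
        rw [h.tr_curvDev_of_two hn2 hy (hN y hy) hV, hG2 hn2 y hy a, mul_zero]
      · rw [h.curvScal_eq_of_two hn2 hy hN hV hF (h2 y hy), hC2 hn2 y hy a b, neg_zero]

end IsPatch
end ConformalCodazzi

/-! ### From coordinate patches to the manifold -/

namespace ConformalCodazzi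

section Smoothness

variable {n : ℕ} {U : Set (Coord n)} {g : Comp2 n}

theorem IsMetricOn.smooth_ricci (hg : IsMetricOn g U) (b d : Fin n) :
    ContDiffOn ℝ ∞ (ricci g b d) U := by
  have hΓ := hg.smooth_christoffel
  refine ContDiffOn.sum fun a _ => ?_
  refine ((contDiffOn_pd a hg.isOpen (hΓ a b d)).sub (contDiffOn_pd b hg.isOpen (hΓ a a d))).add ?_
  exact ContDiffOn.sum fun m _ => ((hΓ a a m).mul (hΓ m b d)).sub ((hΓ a b m).mul (hΓ m a d))

theorem IsMetricOn.smooth_schouten (hg : IsMetricOn g U) (a b : Fin n) :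
    ContDiffOn ℝ ∞ (schouten g a b) U :=
  contDiffOn_const.mul ((hg.smooth_ricci a b).sub
    (((hg.smooth_tr hg.smooth_ricci).div_const _).mul (hg.smooth a b)))

end Smoothness

section Components

variable {n : ℕ} {M : Type*} [TopologicalSpace M] [ChartedSpace (Coord n) M]

theorem CovTensor.IsSymm.comp2_symm {T : CovTensor n M 2} (hT : T.IsSymm)
    (e : OpenPartialHomeomorph M (Coord n)) (a b : Fin n) (y : Coord n) :
    T.comp2 e a b y = T.comp2 e b a y := by
  rw [CovTensor.comp2, ← hT _ (Equiv.swap 0 1)]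
  refine congrArg _ (funext fun j => ?_)
  fin_cases j <;> rfl

theorem CovTensor.IsSymm.comp3_symm_left {T : CovTensor n M 3} (hT : T.IsSymm)
    (e : OpenPartialHomeomorph M (Coord n)) (a b c : Fin n) (y : Coord n) :
    T.comp3 e a b c y = T.comp3 e b a c y := by
  rw [CovTensor.comp3, ← hT _ (Equiv.swap 0 1)]
  refine congrArg _ (funext fun j => ?_)
  fin_cases j <;> rfl

theorem CovTensor.IsSymm.comp3_symm_right {T : CovTensor n M 3} (hT : T.IsSymm)
    (e : OpenPartialHomeomorph M (Coord n)) (a b c : Fin n) (y : Coord n) :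
    T.comp3 e a b c y = T.comp3 e a c b y := by
  rw [CovTensor.comp3, ← hT _ (Equiv.swap 1 2)]
  refine congrArg _ (funext fun j => ?_)
  fin_cases j <;> rfl

end Components

section Charts

variable {n : ℕ} {M : Type*} [TopologicalSpace M] [ChartedSpace (Coord n) M]
  [IsManifold (𝓡 n) ∞ M]

theorem isMetricOn_comp (h : Metric n M) {e : OpenPartialHomeomorph M (Coord n)}
    (he : e ∈ charts n M) : IsMetricOn (h.comp e) e.target where
  isOpen := e.open_target
  smooth := contDiffOn_metricComp h he
  symm := metricComp_symm h e
  posDef _ hy := metricComp_posDef h he hy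

theorem isPatch_comp (hn : 2 ≤ n) (h : Metric n M) (ℙ : CovTensor n M 2)
    (hℙ : n = 2 → IsMobius h ℙ) (E G : CovTensor n M 2) (F : CovTensor n M 1)
    (A : CovTensor n M 3) (hE : E.IsSymm) (hG : G.IsSymm) (hA : A.IsSymm) (hA0 : TraceFree3 h A)
    (hEG : TraceSumZero h E G) (hEG2 : n = 2 → TfDiffZero h E G)
    {e : OpenPartialHomeomorph M (Coord n)} (he : e ∈ charts n M) :
    IsPatch (h.comp e) (rho h ℙ e) (E.comp2 e) (G.comp2 e) (F.comp1 e) (A.comp3 e) e.target where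
  two_le := hn
  metric := isMetricOn_comp h he
  smoothP a b := by
    by_cases hn2 : n = 2
    · rw [rho, if_pos hn2]; exact ℙ.smooth e he ![a, b]
    · rw [rho, if_neg hn2]; exact (isMetricOn_comp h he).smooth_schouten a b
  smoothE a b := E.smooth e he ![a, b]
  smoothG a b := G.smooth e he ![a, b]
  smoothF a := F.smooth e he ![a]
  smoothA a b c := A.smooth e he ![a, b, c]
  symmP y hy a b := by
    by_cases hn2 : n = 2
    · rw [rho, if_pos hn2]; exact (hℙ hn2).1.comp2_symm e a b y
    · rw [rho, if_neg hn2]; exact (isMetricOn_comp h he).schouten_symm hy a b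
  symmE := hE.comp2_symm e
  symmG := hG.comp2_symm e
  symmA := hA.comp3_symm_left e
  symmA' := hA.comp3_symm_right e
  trA := hA0 e he
  trEG := hEG e he
  tfEG hn2 := hEG2 hn2 e he
  schoutenP hn3 := by rw [rho, if_neg (by omega)]
  mobiusP hn2 := by rw [rho, if_pos hn2]; exact (hℙ hn2).2 e he

end Charts

end ConformalCodazzi

theorem proposition5p3 {n : ℕ} (hn : 2 ≤ n) {M : Type*} [TopologicalSpace M]
    [ChartedSpace (EuclideanSpace ℝ (Fin n)) M] [IsManifold (𝓡 n) ∞ M]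
    (h : ConformalCodazzi.Metric n M) (ℙ : ConformalCodazzi.CovTensor n M 2)
    (hℙ : n = 2 → ConformalCodazzi.IsMobius h ℙ)
    (E G : ConformalCodazzi.CovTensor n M 2) (F : ConformalCodazzi.CovTensor n M 1)
    (A : ConformalCodazzi.CovTensor n M 3)
    (hE : E.IsSymm) (hG : G.IsSymm) (hA : A.IsSymm) (hA0 : ConformalCodazzi.TraceFree3 h A)
    (hEG : ConformalCodazzi.TraceSumZero h E G)
    (hEG2 : n = 2 → ConformalCodazzi.TfDiffZero h E G) :
    ConformalCodazzi.IsFlat h ℙ E G F A ↔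
      ConformalCodazzi.Formulas h ℙ E G F A ∧
        (ConformalCodazzi.GaussEq h ℙ A ∧ ConformalCodazzi.CodazziEq h ℙ A) := by
  -- Flatness and both conditions are imposed chart by chart, so the patch equivalences assemble
  -- with no gluing.
  have key := fun e (he : e ∈ ConformalCodazzi.charts n M) =>
    (ConformalCodazzi.isPatch_comp hn h ℙ hℙ E G F A hE hG hA hA0 hEG hEG2 he).flatOn_iff
  constructor
  · intro hf
    exact ⟨fun e he => ((key e he).1 (hf e he)).1, fun e he => ((key e he).1 (hf e he)).2.1,
      fun e he => ((key e he).1 (hf e he)).2.2⟩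
  · rintro ⟨h1, h2, h3⟩ e he
    exact (key e he).2 ⟨h1 e he, h2 e he, h3 e he⟩
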